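/- Conventions. Algorithms are deterministic multi-tape Turing machines. A time-complexity class $\mathcal C$ is given by a collection $\mathcal F$ of nondecreasing functions $f:\mathbb N\to\mathbb N$ with $f(n)\ge n$ such that for every $f\in\mathcal F$ and every integer $C\ge 1$ the function $n\mapsto C f(Cn+C)+C$ is again in $\mathcal F$; a language over a finite alphabet is in $\mathcal C$ if some machine decides it within time $f(n)$ on words of length $n$, for some $f\in\mathcal F$. A function $g$ is subexponential if $g(n)/r^n\to 0$ for every $r>1$, and SubExp is the class of languages decidable in time bounded by a subexponential function. A finite generating set of a group $G$ is a finite alphabet $A$ with a map $A\to G$ whose image generates $G$; every word over the formal alphabet $A\sqcup A^{-1}$ represents an element of $G$. For a subgroup $H\le G$ the membership problem $MP(G,H,A)$ is the language of all words over $A\sqcup A^{-1}$ that represent elements of $H$; it is said to be in a class if this holds for some finite generating set $A$ (membership in SubExp, or in a class $\mathcal C$ as above, does not depend on $A$). The Schreier coset graph of $G$ over $H$ relative to $A$ has the cosets $Hg$ as vertices and, for every coset $Hg$ and every $a\in A$, an edge from $Hg$ to $Hga$ (with a formal inverse edge). It is non-amenable if there is $\varepsilon>0$ such that every finite nonempty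 set $F$ of vertices is joined to its complement by at least $\varepsilon|F|$ edges; this property, too, is required for some finite generating set (and does not depend on it). A discrete probability measure $\mu$ on the set $X^*$ of words is length-invariant if $\mu(w)=\mu(w')$ whenever $|w|=|w'|$. Theorem C. Let $G$ be a finitely presented group, let $H\le G$ be a subgroup such that the membership problem for $H$ in $G$ is in SubExp, let $G_1\le G$ be a subgroup of finite index with $H\le G_1$, and let $\phi:G_1\to\bar G$ be an epimorphism. Let $\mathcal C\subseteq \mathrm{SubExp}$ be a time-complexity class and suppose that there is a subgroup $K$ with $\phi(H)\le K\le\bar G$ such that the Schreier coset graph of $\bar G$ over $K$ is non-amenable and the membership problem for $K$ in $\bar G$ is in $\mathcal C$. Then for every finite generating set $A$ of $G$, with $X=A\sqcup A^{-1}$, the problem $MP(G,H,A)\subseteq X^*$ is solvable with average-case time-complexity in $\mathcal C$, uniformly relative to the family of all length-invariant discrete probability measures on $X^*$. That is, there are a machine $M$ that decides $MP(G,H,A)$ and halts on every $w\in X^*$ after $T(w)<\infty$ steps, a positive nondecreasing function $f$ in the collection $\mathcal F$ of $\mathcal C$, and a constant $0<C<\infty$ such that $$\sum_{w\in X^*}\frac{T(w)}{f(|w|)}\,\mu(w)\le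 C$$ for every length-invariant discrete probability measure $\mu$ on $X^*$. -/

import Mathlib

open scoped ENNReal NNReal Topology
open Filter

universe u

/-! ### Deterministic multi-tape Turing machines -/

/-- A deterministic multi-tape Turing machine with input alphabet `α`. It has finitely many
two-way infinite tapes, indexed by `ι`, one of which is the input tape, a finite tape alphabet `Γ`
whose `default` symbol is the blank and which contains `α` as non-blank symbols, and a finite set
`Q` of working states. Depending on the working state and on the scanned symbols, one step moves
to a working state or to one of the halting states `true` ("yes") and `false` ("no"), overwrites
the scanned symbol of each tape and moves each head left, right or not at all. -/
structure MultiTapeTM (α : Type u) where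
  ι : Type
  finι : Finite ι
  inputTape : ι
  Γ : Type
  finΓ : Finite Γ
  inhΓ : Inhabited Γ
  embed : α → Γ
  embed_injective : Function.Injective embed
  embed_ne_blank : ∀ a, embed a ≠ default
  Q : Type
  finQ : Finite Q
  start : Q
  δ : Q → (ι → Γ) → (Q ⊕ Bool) × (ι → Γ × Option Turing.Dir)

namespace MultiTapeTM

variable {α : Type u} (M : MultiTapeTM α)

attribute [instance] MultiTapeTM.finι MultiTapeTM.finΓ MultiTapeTM.inhΓ MultiTapeTM.finQ

/-- A configuration: the current state and the contents of the tapes with the head positions. -/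
structure Cfg where
  state : M.Q ⊕ Bool
  tape : M.ι → Turing.Tape M.Γ

/-- The initial configuration: the input stands on the input tape, its head scans the first letter,
and all other tapes are blank. -/
noncomputable def init (w : List α) : M.Cfg where
  state := Sum.inl M.start
  tape := fun i => by
    classical exact if i = M.inputTape then Turing.Tape.mk₁ (w.map M.embed) else default

/-- The action of one tape operation: write a symbol, then move the head (or leave it). -/
def act {Γ : Type} [Inhabited Γ] (a : Γ × Option Turing.Dir) (T : Turing.Tape Γ) :
    Turing.Tape Γ :=
  match a.2 with
  | none => T.write a.1
  | some d => (T.write a.1).move d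

/-- One step of the computation; a halted configuration does not change any more. -/
def step (c : M.Cfg) : M.Cfg :=
  match c.state with
  | Sum.inr _ => c
  | Sum.inl q =>
    let a := M.δ q (fun i => (c.tape i).head)
    { state := a.1, tape := fun i => act (a.2 i) (c.tape i) }

/-- The configuration after `t` steps on input `w`. -/
noncomputable def run (w : List α) (t : ℕ) : M.Cfg := M.step^[t] (M.init w)

/-- The number of steps that `M` makes on input `w` until it halts (`⊤` if it does not halt). -/
noncomputable def time (w : List α) : ℕ∞ :=
  ⨅ (t : ℕ) (_ : ∃ b : Bool, (M.run w t).state = Sum.inr b), (t : ℕ∞)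

/-- `M` decides the language `L`: on every input it halts, in the state "yes" on the words of `L`
and in the state "no" on all other words. -/
def Decides (L : Language α) : Prop :=
  ∀ w : List α, ∃ (t : ℕ) (b : Bool), (M.run w t).state = Sum.inr b ∧ (b = true ↔ w ∈ L)

end MultiTapeTM

/-! ### Time-complexity classes -/

/-- `L` is decided by a deterministic multi-tape Turing machine in time `f`. -/
def DecidableInTime {α : Type u} (L : Language α) (f : ℕ → ℕ) : Prop :=
  ∃ M : MultiTapeTM α, M.Decides L ∧ ∀ w : List α, M.time w ≤ (f w.length : ℕ∞)

/-- A deterministic time-complexity class, given by its collection of time bounds. The bounds need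
not be constructible, so the collections of proper complexity functions are among these. -/
structure TimeClass where
  bounds : Set (ℕ → ℕ)
  monotone : ∀ f ∈ bounds, Monotone f
  le_apply : ∀ f ∈ bounds, ∀ n, n ≤ f n
  closed : ∀ f ∈ bounds, ∀ C : ℕ, 1 ≤ C → (fun n => C * f (C * n + C) + C) ∈ bounds

/-- The language `L` belongs to the time-complexity class `𝓒`. -/
def TimeClass.Contains (𝓒 : TimeClass) {α : Type u} (L : Language α) : Prop :=
  ∃ f ∈ 𝓒.bounds, DecidableInTime L f

/-- Subexponential functions. -/
def IsSubexponential (f : ℕ → ℝ) : Prop :=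
  ∀ r : ℝ, 1 < r → Tendsto (fun n => f n / r ^ n) atTop (𝓝 0)

/-- `L` is decidable in deterministic subexponential time. -/
def InSubExp {α : Type u} (L : Language α) : Prop :=
  ∃ g : ℕ → ℕ, IsSubexponential (fun n => (g n : ℝ)) ∧ DecidableInTime L g

/-- Every language (over a finite alphabet) of the class `𝓒` is in SubExp. -/
def TimeClass.SubsetSubExp (𝓒 : TimeClass) : Prop :=
  ∀ (α : Type) [Finite α] (L : Language α), 𝓒.Contains L → InSubExp L

/-! ### Average-case complexity -/

/-- A discrete probability measure on words is length-invariant if words of the same length have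
the same probability. -/
def LengthInvariant {α : Type u} (μ : PMF (List α)) : Prop :=
  ∀ w w' : List α, w.length = w'.length → μ w = μ w'

/-- `M` decides `L` with average-case time-complexity bounded by `f`, uniformly relative to the
family `R` of discrete probability measures. -/
def MultiTapeTM.SolvesOnAverage {α : Type u} (M : MultiTapeTM α) (L : Language α) (f : ℕ → ℕ)
    (R : Set (PMF (List α))) : Prop :=
  M.Decides L ∧ Monotone f ∧ (∀ n, 0 < f n) ∧
    ∃ C : ℝ≥0, 0 < C ∧ ∀ μ ∈ R,
      ∑' w : List α, (M.time w : ℝ≥0∞) / (f w.length : ℝ≥0∞) * μ w ≤ (C : ℝ≥0∞)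

/-- `L` is solvable with average-case time-complexity in `𝓒`, uniformly relative to `R`. -/
def TimeClass.ContainsOnAverage (𝓒 : TimeClass) {α : Type u} (L : Language α)
    (R : Set (PMF (List α))) : Prop :=
  ∃ M : MultiTapeTM α, ∃ f ∈ 𝓒.bounds, M.SolvesOnAverage L f R

/-! ### Groups: words, membership problems, Schreier coset graphs -/

section Groups

variable {A : Type*} {G : Type*} [Group G]

/-- `π : A → G` makes the alphabet `A` a generating set of `G`. -/
def Generates (π : A → G) : Prop := Subgroup.closure (Set.range π) = ⊤

/-- The element of `G` given by a letter of `A ⊔ A⁻¹`; `(a, true)` stands for the letter `a` and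
`(a, false)` for `a⁻¹`. -/
def letterVal (π : A → G) (x : A × Bool) : G := if x.2 then π x.1 else (π x.1)⁻¹

/-- The element of `G` represented by a word in `A ⊔ A⁻¹`. -/
def wordVal (π : A → G) (w : List (A × Bool)) : G := (w.map (letterVal π)).prod

/-- The membership problem for `H` in `G` relative to `(A, π)`: all words in `A ⊔ A⁻¹` that
represent elements of `H`. -/
def membershipProblem (π : A → G) (H : Subgroup G) : Language (A × Bool) :=
  {w | wordVal π w ∈ H}

/-- The set of right cosets `H g`. -/
abbrev RightCosets (H : Subgroup G) := Quotient (QuotientGroup.rightRel H)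

/-- Right translation of right cosets: `H g ↦ H g x`. -/
def RightCosets.translate (H : Subgroup G) (x : G) : RightCosets H → RightCosets H :=
  Quotient.map (fun g => g * x) (by
    intro a b h
    change QuotientGroup.rightRel H _ _ at h
    change QuotientGroup.rightRel H _ _
    rw [QuotientGroup.rightRel_apply] at h ⊢
    simpa [mul_assoc] using h)

/-- Oriented edges of the Schreier coset graph of `G` over `H` relative to `(A, π)`: the edge
`(v, x)` starts at the coset `v`, has the label `x ∈ A ⊔ A⁻¹` and ends at the coset `v x`. The
inverse of the edge `(v, (a, true))` is the edge `(v a, (a, false))`. -/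
abbrev SchreierEdge (H : Subgroup G) (A : Type*) := RightCosets H × (A × Bool)

/-- The end vertex of an edge of the Schreier coset graph. -/
def SchreierEdge.terminus (π : A → G) {H : Subgroup G} (e : SchreierEdge H A) : RightCosets H :=
  RightCosets.translate H (letterVal π e.2) e.1

/-- The edges of the Schreier coset graph that lead from `F` to its complement. -/
def schreierBoundary (π : A → G) {H : Subgroup G} (F : Set (RightCosets H)) :
    Set (SchreierEdge H A) :=
  {e | e.1 ∈ F ∧ SchreierEdge.terminus π e ∉ F}

/-- The Schreier coset graph of `G` over `H` relative to `(A, π)` is non-amenable: its isoperimetric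
constant is positive (the Følner condition fails). -/
def SchreierNonamenable (π : A → G) (H : Subgroup G) : Prop :=
  ∃ ε : ℝ, 0 < ε ∧ ∀ F : Set (RightCosets H), F.Finite → F.Nonempty →
    ε * (F.ncard : ℝ) ≤ ((schreierBoundary π F).ncard : ℝ)

end Groups

/-- The membership problem for `H` in `G` is in SubExp (relative to some finite generating set). -/
def MembershipInSubExp {G : Type*} [Group G] (H : Subgroup G) : Prop :=
  ∃ (n : ℕ) (π : Fin n → G), Generates π ∧ InSubExp (membershipProblem π H)

/-- The membership problem for `H` in `G` is in the class `𝓒` (relative to some finite generating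
set). -/
def MembershipIn (𝓒 : TimeClass) {G : Type*} [Group G] (H : Subgroup G) : Prop :=
  ∃ (n : ℕ) (π : Fin n → G), Generates π ∧ 𝓒.Contains (membershipProblem π H)

/-- The Schreier coset graph of the finitely generated group `G` over `H` is non-amenable (for some
finite generating set). -/
def HasNonamenableSchreierGraph {G : Type*} [Group G] (H : Subgroup G) : Prop :=
  ∃ (n : ℕ) (π : Fin n → G), Generates π ∧ SchreierNonamenable π H

/-!
A cocycle `G × G ⧸ G₁ → G₁` composed with `φ` turns the product of `G ⧸ G₁` and `Gbar ⧸ K` into a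
`G`-set with a point whose stabilizer contains `H`. Non-amenability passes to this `G`-set, so by
Cheeger's inequality the words of length `n` that fix the point number at most `c ^ n` for some
`c < |X|`. A machine that rewrites its input for the two membership problems and runs the fast test
for `K` simultaneously with the slow test for `H`, rejecting as soon as the former does, is thus
slow only on this exponentially small set of words, where a subexponential time bound does not
affect the average.
-/

universe v

/-! ### Running times and tape operations -/

namespace MultiTapeTM

variable {α : Type u} (M : MultiTapeTM α)

theorem time_le_of_halt {w : List α} {t : ℕ} {b : Bool} (h : (M.run w t).state = Sum.inr b) :
    M.time w ≤ t :=
  iInf₂_le t ⟨b, h⟩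

theorem step_of_halt {c : M.Cfg} {b : Bool} (h : c.state = Sum.inr b) : M.step c = c := by
  simp [step, h]

theorem run_of_halt {w : List α} {s t : ℕ} {b : Bool} (h : (M.run w s).state = Sum.inr b)
    (hst : s ≤ t) : M.run w t = M.run w s := by
  obtain ⟨k, rfl⟩ := Nat.exists_eq_add_of_le' hst
  rw [run, Function.iterate_add_apply]
  exact Function.iterate_fixed (M.step_of_halt h) k

theorem Decides.exists_time_eq {M : MultiTapeTM α} {L : Language α} (h : M.Decides L)
    (w : List α) :
    ∃ (t : ℕ) (b : Bool), M.time w = t ∧ (M.run w t).state = Sum.inr b ∧ (b = true ↔ w ∈ L) := by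
  classical
  obtain ⟨t₀, b₀, h₀, hb₀⟩ := h w
  have halts : ∃ t, ∃ b : Bool, (M.run w t).state = Sum.inr b := ⟨t₀, b₀, h₀⟩
  obtain ⟨b, hb⟩ := Nat.find_spec halts
  refine ⟨Nat.find halts, b, le_antisymm (M.time_le_of_halt hb) ?_, hb, ?_⟩
  · exact le_iInf₂ fun t ht => by exact_mod_cast Nat.find_min' halts ht
  · rw [M.run_of_halt hb (Nat.find_min' halts ⟨b₀, h₀⟩), hb] at h₀
    rwa [Sum.inr_injective h₀]

/-- The transition function extended to the halting states, in which the machine idles. -/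
def trans (q : M.Q ⊕ Bool) (sym : M.ι → M.Γ) : (M.Q ⊕ Bool) × (M.ι → M.Γ × Option Turing.Dir) :=
  match q with
  | Sum.inl q => M.δ q sym
  | Sum.inr b => (Sum.inr b, fun i => (sym i, none))

@[simp]
theorem act_head_none {Γ : Type} [Inhabited Γ] (T : Turing.Tape Γ) : act (T.head, none) T = T := by
  simp [act]

theorem map_act {Γ Γ' : Type} [Inhabited Γ] [Inhabited Γ'] (f : Turing.PointedMap Γ Γ')
    (a : Γ × Option Turing.Dir) (T : Turing.Tape Γ) :
    (act a T).map f = act (f a.1, a.2) (T.map f) := by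
  obtain ⟨g, _ | d⟩ := a <;> simp [act, Turing.Tape.map_write, Turing.Tape.map_move]

theorem step_eq_trans (c : M.Cfg) :
    M.step c =
      ⟨(M.trans c.state fun i => (c.tape i).head).1,
        fun i => act ((M.trans c.state fun i => (c.tape i).head).2 i) (c.tape i)⟩ := by
  obtain ⟨q | b, T⟩ := c <;> simp [step, trans]

open Classical in
/-- The family of tapes whose input tape is `T`, all other tapes being blank. -/
noncomputable def inputOnly (T : Turing.Tape M.Γ) : M.ι → Turing.Tape M.Γ :=
  Function.update (fun _ => default) M.inputTape T

open Classical in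
/-- The family of tape operations that performs `a` on the input tape and, as `sym` are the scanned
symbols, leaves the other tapes unchanged. -/
noncomputable def inputOp (sym : M.ι → M.Γ) (a : M.Γ × Option Turing.Dir) :
    M.ι → M.Γ × Option Turing.Dir :=
  Function.update (fun i => (sym i, none)) M.inputTape a

theorem init_tape (w : List α) :
    (M.init w).tape = M.inputOnly (Turing.Tape.mk₁ (w.map M.embed)) := by
  funext i
  by_cases h : i = M.inputTape
  · subst h; simp [init, inputOnly]
  · simp [init, inputOnly, h]

theorem act_inputOp (T : Turing.Tape M.Γ) (a : M.Γ × Option Turing.Dir) :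
    (fun i => act (M.inputOp (fun i => (M.inputOnly T i).head) a i) (M.inputOnly T i)) =
      M.inputOnly (act a T) := by
  funext i
  by_cases h : i = M.inputTape
  · subst h; simp [inputOp, inputOnly]
  · simp [inputOp, inputOnly, h]

/-- The tapes with the word `w` on the input tape, whose head scans the blank in front of `w`. -/
noncomputable def headBefore (w : List α) : M.ι → Turing.Tape M.Γ :=
  M.inputOnly ((Turing.Tape.mk₁ (w.map M.embed)).move .left)

/-- The operations that write the letter (if any) on the input tape and then move left. -/
noncomputable def prepend (sym : M.ι → M.Γ) : Option α → M.ι → M.Γ × Option Turing.Dir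
  | none => fun i => (sym i, none)
  | some x => M.inputOp sym (M.embed x, some .left)

theorem headBefore_nil : M.headBefore [] = fun _ => default := by
  have blank : (Turing.Tape.mk₁ ([] : List M.Γ)).move .left = default := by
    rw [Turing.Tape.mk₁, Turing.Tape.mk₂, Turing.Tape.move_left_mk', Turing.ListBlank.tail_mk,
      Turing.ListBlank.head_mk, Turing.ListBlank.cons_mk]
    change Turing.Tape.mk' _ _ = Turing.Tape.mk' (Turing.ListBlank.mk []) (Turing.ListBlank.mk [])
    congr 1
    exact Quotient.sound' (Or.inr ⟨1, rfl⟩)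
  simp [headBefore, inputOnly, blank]

theorem act_prepend (x : Option α) (w : List α) :
    (fun i => act (M.prepend (fun i => (M.headBefore w i).head) x i) (M.headBefore w i)) =
      M.headBefore (x.toList ++ w) := by
  obtain _ | x := x
  · simp [prepend]
  · rw [prepend, headBefore, act_inputOp]
    simp [headBefore, act, Turing.Tape.mk₁, Turing.Tape.mk₂, Turing.Tape.write_mk']

theorem act_enter (w : List α) :
    (fun i => act (M.inputOp (fun i => (M.headBefore w i).head)
      ((M.headBefore w M.inputTape).head, some .right) i) (M.headBefore w i)) =
        (M.init w).tape := by
  rw [headBefore, act_inputOp, init_tape]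
  simp [inputOnly, act]

end MultiTapeTM

/-! ### Machines with a separate alphabet on each tape -/

/-- A multi-tape Turing machine whose tapes have individual alphabets and whose working states are
in an arbitrary universe. It is only an intermediate device: `TypedTapeTM.toMultiTapeTM` is a
machine with a common tape alphabet that simulates it step by step. -/
structure TypedTapeTM (α : Type u) where
  ι : Type
  finι : Finite ι
  Γ : ι → Type
  finΓ : ∀ i, Finite (Γ i)
  inhΓ : ∀ i, Inhabited (Γ i)
  inputTape : ι
  embed : α → Γ inputTape
  embed_injective : Function.Injective embed
  embed_ne_blank : ∀ a, embed a ≠ default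
  Q : Type v
  finQ : Finite Q
  start : Q
  δ : Q → (∀ i, Γ i) → (Q ⊕ Bool) × (∀ i, Γ i × Option Turing.Dir)

namespace TypedTapeTM

open MultiTapeTM (act)

variable {α : Type u} (M : TypedTapeTM.{u, v} α)

attribute [instance] TypedTapeTM.finι TypedTapeTM.finΓ TypedTapeTM.inhΓ TypedTapeTM.finQ

/-- A configuration: the current state and the contents of the tapes with the head positions. -/
@[ext]
structure Cfg where
  state : M.Q ⊕ Bool
  tape : ∀ i, Turing.Tape (M.Γ i)

open Classical in
/-- The initial configuration on a given input. -/
noncomputable def init (w : List α) : M.Cfg where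
  state := Sum.inl M.start
  tape := Function.update (fun _ => default) M.inputTape (Turing.Tape.mk₁ (w.map M.embed))

/-- One step of the computation; a halted configuration does not change any more. -/
def step (c : M.Cfg) : M.Cfg :=
  match c.state with
  | Sum.inr _ => c
  | Sum.inl q =>
    let a := M.δ q (fun i => (c.tape i).head)
    { state := a.1, tape := fun i => act (a.2 i) (c.tape i) }

theorem step_of_halt {c : M.Cfg} {b : Bool} (h : c.state = Sum.inr b) : M.step c = c := by
  simp [step, h]

open Classical in
/-- The simulating machine. Its common tape alphabet is the product of the individual alphabets,
and the tape `i` uses the symbols that are blank outside the component `i`. -/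
noncomputable abbrev toMultiTapeTM : MultiTapeTM α where
  ι := M.ι
  finι := inferInstance
  inputTape := M.inputTape
  Γ := ∀ i, M.Γ i
  finΓ := inferInstance
  inhΓ := inferInstance
  embed x := Function.update default M.inputTape (M.embed x)
  embed_injective := (Function.update_injective _ _).comp M.embed_injective
  embed_ne_blank x h := M.embed_ne_blank x <| by simpa using congrFun h M.inputTape
  Q := Fin (Nat.card M.Q)
  finQ := inferInstance
  start := Finite.equivFin M.Q M.start
  δ q sym :=
    let a := M.δ ((Finite.equivFin M.Q).symm q) (fun i => sym i i)
    (a.1.map (Finite.equivFin M.Q) id,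
      fun i => (Function.update default i (a.2 i).1, (a.2 i).2))

/-- The projection of the common alphabet to the alphabet of the tape `i`. -/
def symbolAt (i : M.ι) : Turing.PointedMap (∀ i, M.Γ i) (M.Γ i) :=
  ⟨fun sym => sym i, rfl⟩

/-- The configuration that is encoded by a configuration of the simulating machine. -/
noncomputable def decode (c : M.toMultiTapeTM.Cfg) : M.Cfg where
  state := Sum.map (Finite.equivFin M.Q).symm id c.state
  tape i := Turing.Tape.map (M.symbolAt i) (c.tape i)

theorem decode_init (w : List α) : M.decode (M.toMultiTapeTM.init w) = M.init w := by
  classical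
  ext1
  · exact congrArg Sum.inl ((Finite.equivFin M.Q).symm_apply_apply M.start)
  · funext i
    obtain rfl | h := eq_or_ne i M.inputTape
    · have tape_init : (M.toMultiTapeTM.init w).tape M.inputTape =
        Turing.Tape.mk₁ (w.map M.toMultiTapeTM.embed) := if_pos rfl
      simp only [decode, init, tape_init, Function.update_self]
      refine (Turing.Tape.map_mk₁ ..).trans (congrArg _ ((List.map_map ..).trans ?_))
      simp [symbolAt]
    · have tape_init : (M.toMultiTapeTM.init w).tape i = default := if_neg h
      simp only [decode, init, tape_init, Function.update_of_ne h]
      rfl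

theorem decode_step (c : M.toMultiTapeTM.Cfg) :
    M.decode (M.toMultiTapeTM.step c) = M.step (M.decode c) := by
  obtain ⟨q | b, T⟩ := c
  · let a := M.δ ((Finite.equivFin M.Q).symm q) fun i => (T i).head i
    have step_decode : M.step (M.decode ⟨Sum.inl q, T⟩) =
        ⟨a.1, fun i => act (a.2 i) (Turing.Tape.map (M.symbolAt i) (T i))⟩ := by
      have heads : (fun i => (Turing.Tape.map (M.symbolAt i) (T i)).head) =
          fun i => (T i).head i := funext fun i => Turing.Tape.map_fst _ _
      simp only [step, decode, Sum.map_inl, heads, a]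
    rw [step_decode]
    ext1
    · change Sum.map _ id (Sum.map (Finite.equivFin M.Q) id a.1) = a.1
      simp [Sum.map_map]
    · funext i
      refine (MultiTapeTM.map_act (M.symbolAt i) _ (T i)).trans ?_
      simp [symbolAt, a]
  · rfl

theorem state_run_toMultiTapeTM_of_halt {w : List α} {t : ℕ} {b : Bool}
    (h : (M.step^[t] (M.init w)).state = Sum.inr b) :
    (M.toMultiTapeTM.run w t).state = Sum.inr b := by
  have decode_run : M.decode (M.toMultiTapeTM.run w t) = M.step^[t] (M.init w) := by
    rw [← decode_init, MultiTapeTM.run]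
    exact Function.Semiconj.iterate_right (f := M.decode) M.decode_step t _
  rw [← decode_run] at h
  cases hq : (M.toMultiTapeTM.run w t).state with
  | inl q => simp [decode, hq] at h
  | inr b' => simpa [decode, hq] using h

end TypedTapeTM

/-! ### Transducing the input for two machines -/

/-- The output of a finite-state transducer that reads its input from right to left, starting in
the state `s₀`, so that `w.foldr next s₀` is its state when it has read `w`. -/
def transduce {α S β : Type*} (next : α → S → S) (out : α → S → List β) (s₀ : S) :
    List α → List β
  | [] => []
  | x :: w => out x (w.foldr next s₀) ++ transduce next out s₀ w

theorem length_transduce_le {α S β : Type*} {next : α → S → S} {out : α → S → List β} {k : ℕ}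
    (hk : ∀ x s, (out x s).length ≤ k) (s₀ : S) (w : List α) :
    (transduce next out s₀ w).length ≤ k * w.length := by
  induction w with
  | nil => simp [transduce]
  | cons x w ih =>
    simp only [transduce, List.length_append, List.length_cons]
    linarith [hk x (w.foldr next s₀)]

/-- The data of a machine that transduces its input into one input word for each of the machines
`M₁` and `M₂`, runs these two simultaneously if the final state of the transducer is accepting, and
says "no" as soon as `M₁` does so. -/
structure Pipeline (α : Type u) (β₁ : Type*) (β₂ : Type*) where
  M₁ : MultiTapeTM β₁
  M₂ : MultiTapeTM β₂
  S : Type v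
  finS : Finite S
  init : S
  next : α → S → S
  out₁ : α → S → List β₁
  out₂ : α → S → List β₂
  acc : S → Bool
  maxLen : ℕ
  length_out₁_le : ∀ x s, (out₁ x s).length ≤ maxLen
  length_out₂_le : ∀ x s, (out₂ x s).length ≤ maxLen

namespace Pipeline

open MultiTapeTM (act)
open Turing (Tape)

variable {α : Type u} {β₁ β₂ : Type*} (P : Pipeline.{u, v} α β₁ β₂)

attribute [instance] Pipeline.finS

/-- The input word of `M₁`. -/
def output₁ : List α → List β₁ := transduce P.next P.out₁ P.init

/-- The input word of `M₂`. -/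
def output₂ : List α → List β₂ := transduce P.next P.out₂ P.init

theorem time_output₁_le {f : ℕ → ℕ} (hf : Monotone f) (h : ∀ v, P.M₁.time v ≤ (f v.length : ℕ∞))
    {k : ℕ} (hk : P.maxLen ≤ k) (w : List α) : P.M₁.time (P.output₁ w) ≤ f (k * w.length) :=
  (h _).trans <| mod_cast hf <|
    (length_transduce_le P.length_out₁_le _ w).trans (Nat.mul_le_mul_right _ hk)

theorem time_output₂_le {f : ℕ → ℕ} (hf : Monotone f) (h : ∀ v, P.M₂.time v ≤ (f v.length : ℕ∞))
    {k : ℕ} (hk : P.maxLen ≤ k) (w : List α) : P.M₂.time (P.output₂ w) ≤ f (k * w.length) :=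
  (h _).trans <| mod_cast hf <|
    (length_transduce_le P.length_out₂_le _ w).trans (Nat.mul_le_mul_right _ hk)

/-- The time that the transducer needs for the word `w`. -/
def prepTime (w : List α) : ℕ := 1 + (P.maxLen + 2) * w.length + 1 + w.length

theorem prepTime_le (w : List α) : P.prepTime w ≤ (P.maxLen + 3) * (w.length + 1) := by
  rw [prepTime]
  nlinarith

/-- The working states: moving to the right end of the input, reading the input from right to left,
writing the output for the letter `x` read in the state `s` (of which the letters from the index
`i` on have been written), and running the two machines, one of which may have halted. -/
inductive State (α S Q₁ Q₂ : Type*) (k : ℕ)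
  | seek
  | read (s : S)
  | emit (x : α) (s : S) (i : Fin (k + 1))
  | run (q₁ : Q₁ ⊕ Bool) (q₂ : Q₂ ⊕ Bool)

instance {S Q₁ Q₂ : Type*} {k : ℕ} [Finite α] [Finite S] [Finite Q₁] [Finite Q₂] :
    Finite (State α S Q₁ Q₂ k) :=
  Finite.of_surjective (α := Unit ⊕ S ⊕ (α × S × Fin (k + 1)) ⊕ ((Q₁ ⊕ Bool) × (Q₂ ⊕ Bool)))
    (fun
      | .inl _ => .seek
      | .inr (.inl s) => .read s
      | .inr (.inr (.inl (x, s, i))) => .emit x s i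
      | .inr (.inr (.inr (q₁, q₂))) => .run q₁ q₂)
    (fun
      | .seek => ⟨.inl (), rfl⟩
      | .read s => ⟨.inr (.inl s), rfl⟩
      | .emit x s i => ⟨.inr (.inr (.inl (x, s, i))), rfl⟩
      | .run q₁ q₂ => ⟨.inr (.inr (.inr (q₁, q₂))), rfl⟩)

/-- The working states of the combined machine. -/
abbrev Q := State α P.S P.M₁.Q P.M₂.Q P.maxLen

/-- The state of the combined machine when `M₁` and `M₂` are in the given states. -/
def verdict : P.M₁.Q ⊕ Bool → P.M₂.Q ⊕ Bool → P.Q ⊕ Bool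
  | Sum.inr false, _ => Sum.inr false
  | Sum.inr true, Sum.inr b => Sum.inr b
  | q₁, q₂ => Sum.inl (.run q₁ q₂)

theorem verdict_step {c₁ : P.M₁.Cfg} {c₂ : P.M₂.Cfg} {b : Bool}
    (h : P.verdict c₁.state c₂.state = Sum.inr b) :
    P.verdict (P.M₁.step c₁).state (P.M₂.step c₂).state = Sum.inr b := by
  obtain ⟨q₁ | _ | _, T₁⟩ := c₁ <;> obtain ⟨q₂ | b₂, T₂⟩ := c₂ <;>
    simp_all [verdict, MultiTapeTM.step]

theorem verdict_eq_inl {q₁ : P.M₁.Q ⊕ Bool} {q₂ : P.M₂.Q ⊕ Bool} {q : P.Q}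
    (h : P.verdict q₁ q₂ = Sum.inl q) : q = .run q₁ q₂ := by
  obtain q₁ | _ | _ := q₁ <;> obtain q₂ | b₂ := q₂ <;> simp_all [verdict]

/-- The alphabets of the tapes: a read-only input tape and the tapes of `M₁` and of `M₂`. -/
abbrev Alphabet [Finite α] : Option (P.M₁.ι ⊕ P.M₂.ι) → Type
  | none => Option (Fin (Nat.card α))
  | some (.inl _) => P.M₁.Γ
  | some (.inr _) => P.M₂.Γ

variable [Finite α]

instance : ∀ i, Inhabited (P.Alphabet i)
  | none => inferInstanceAs (Inhabited (Option _))
  | some (.inl _) => P.M₁.inhΓ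
  | some (.inr _) => P.M₂.inhΓ

instance : ∀ i, Finite (P.Alphabet i)
  | none => inferInstanceAs (Finite (Option _))
  | some (.inl _) => P.M₁.finΓ
  | some (.inr _) => P.M₂.finΓ

/-- The operations on the input tape and on the tapes of `M₁` and of `M₂` as one family. -/
def operations (x : Option (Fin (Nat.card α))) (d : Option Turing.Dir)
    (a₁ : P.M₁.ι → P.M₁.Γ × Option Turing.Dir) (a₂ : P.M₂.ι → P.M₂.Γ × Option Turing.Dir) :
    ∀ i, P.Alphabet i × Option Turing.Dir
  | none => (x, d)
  | some (.inl i) => a₁ i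
  | some (.inr i) => a₂ i

/-- The transition function in terms of the symbols `x` on the input tape, `sym₁` on the tapes of
`M₁` and `sym₂` on the tapes of `M₂`. The input tape is moved, but not changed. -/
noncomputable def trans (q : P.Q) (x : Option α) (sym₁ : P.M₁.ι → P.M₁.Γ)
    (sym₂ : P.M₂.ι → P.M₂.Γ) :
    (P.Q ⊕ Bool) × Option Turing.Dir × (P.M₁.ι → P.M₁.Γ × Option Turing.Dir) ×
      (P.M₂.ι → P.M₂.Γ × Option Turing.Dir) :=
  match q, x with
  | .seek, some _ =>
    (Sum.inl .seek, some .right, P.M₁.prepend sym₁ none, P.M₂.prepend sym₂ none)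
  | .seek, none =>
    (Sum.inl (.read P.init), some .left, P.M₁.prepend sym₁ none, P.M₂.prepend sym₂ none)
  | .read s, some x =>
    (Sum.inl (.emit x s (Fin.last _)), some .left, P.M₁.prepend sym₁ none,
      P.M₂.prepend sym₂ none)
  | .read s, none =>
    (if P.acc s then Sum.inl (.run (Sum.inl P.M₁.start) (Sum.inl P.M₂.start)) else Sum.inr false,
      none, P.M₁.inputOp sym₁ (sym₁ P.M₁.inputTape, some .right),
      P.M₂.inputOp sym₂ (sym₂ P.M₂.inputTape, some .right))
  | .emit x s ⟨i + 1, hi⟩, _ =>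
    (Sum.inl (.emit x s ⟨i, Nat.lt_of_succ_lt hi⟩), none, P.M₁.prepend sym₁ (P.out₁ x s)[i]?,
      P.M₂.prepend sym₂ (P.out₂ x s)[i]?)
  | .emit x s ⟨0, _⟩, _ =>
    (Sum.inl (.read (P.next x s)), none, P.M₁.prepend sym₁ none, P.M₂.prepend sym₂ none)
  | .run q₁ q₂, _ =>
    (P.verdict (P.M₁.trans q₁ sym₁).1 (P.M₂.trans q₂ sym₂).1, none, (P.M₁.trans q₁ sym₁).2,
      (P.M₂.trans q₂ sym₂).2)

/-- The combined machine with a separate alphabet on each tape. -/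
noncomputable abbrev typedMachine : TypedTapeTM.{u, max u v} α where
  ι := Option (P.M₁.ι ⊕ P.M₂.ι)
  finι := inferInstance
  Γ := P.Alphabet
  finΓ := inferInstance
  inhΓ := inferInstance
  inputTape := none
  embed x := some (Finite.equivFin α x)
  embed_injective := (Option.some_injective _).comp (Finite.equivFin α).injective
  embed_ne_blank _ := Option.some_ne_none _
  Q := P.Q
  finQ := inferInstance
  start := .seek
  δ q sym :=
    let a := P.trans q ((sym none).map (Finite.equivFin α).symm) (fun i => sym (some (.inl i)))
      (fun i => sym (some (.inr i)))
    (a.1, P.operations (sym none) a.2.1 a.2.2.1 a.2.2.2)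

/-- The combined machine. -/
noncomputable def machine : MultiTapeTM α := P.typedMachine.toMultiTapeTM

/-- The input tape with the letters `u`, in reversed order, to the left of the head and `w` to the
right of it, where the head scans the first letter of `w`. -/
noncomputable def inputAt (u w : List α) : Tape (Option (Fin (Nat.card α))) :=
  Tape.mk₂ (u.map fun x => some (Finite.equivFin α x)) (w.map fun x => some (Finite.equivFin α x))

/-- The configuration with the given state and the given contents of the tapes. -/
def cfg (q : P.Q ⊕ Bool) (T : Tape (Option (Fin (Nat.card α)))) (T₁ : P.M₁.ι → Tape P.M₁.Γ)
    (T₂ : P.M₂.ι → Tape P.M₂.Γ) : P.typedMachine.Cfg where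
  state := q
  tape
    | none => T
    | some (.inl i) => T₁ i
    | some (.inr i) => T₂ i

/-- The configuration in the state `q` in which `o₁` and `o₂` are the outputs written so far. As
they grow to the left, the heads stand before them. -/
noncomputable def transducing (q : P.Q) (T : Tape (Option (Fin (Nat.card α))))
    (o₁ : List β₁) (o₂ : List β₂) : P.typedMachine.Cfg :=
  P.cfg (Sum.inl q) T (P.M₁.headBefore o₁) (P.M₂.headBefore o₂)

theorem init_eq (w : List α) :
    P.typedMachine.init w = P.transducing .seek (inputAt [] w) [] [] := by
  ext1
  · rfl
  · funext i
    obtain _ | i | i := i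
    · simp [transducing, cfg, TypedTapeTM.init, inputAt, Tape.mk₁]
    · simp [transducing, cfg, TypedTapeTM.init, MultiTapeTM.headBefore_nil]
    · simp [transducing, cfg, TypedTapeTM.init, MultiTapeTM.headBefore_nil]

theorem step_cfg {q : P.Q} {T T₁ T₂} {x : Option α}
    (hx : T.head.map (Finite.equivFin α).symm = x) {q' d a₁ a₂}
    (h : P.trans q x (fun i => (T₁ i).head) (fun i => (T₂ i).head) = (q', d, a₁, a₂)) :
    P.typedMachine.step (P.cfg (Sum.inl q) T T₁ T₂) =
      P.cfg q' (act (T.head, d) T) (fun i => act (a₁ i) (T₁ i)) (fun i => act (a₂ i) (T₂ i)) := by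
  subst hx
  ext1
  · exact congrArg (·.1) h
  · funext i
    obtain _ | i | i := i
    · exact congrArg (fun a => act (T.head, a.2.1) T) h
    · exact congrArg (fun a => act (a.2.2.1 i) (T₁ i)) h
    · exact congrArg (fun a => act (a.2.2.2 i) (T₂ i)) h

theorem step_transducing {q : P.Q} {T o₁ o₂} {x : Option α}
    (hx : T.head.map (Finite.equivFin α).symm = x) {q' d y₁ y₂}
    (h : ∀ sym₁ sym₂, P.trans q x sym₁ sym₂ =
      (Sum.inl q', d, P.M₁.prepend sym₁ y₁, P.M₂.prepend sym₂ y₂)) :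
    P.typedMachine.step (P.transducing q T o₁ o₂) =
      P.transducing q' (act (T.head, d) T) (y₁.toList ++ o₁) (y₂.toList ++ o₂) := by
  rw [transducing, P.step_cfg hx (h _ _), transducing, MultiTapeTM.act_prepend,
    MultiTapeTM.act_prepend]

theorem iterate_seek (u w : List α) :
    P.typedMachine.step^[w.length] (P.transducing .seek (inputAt u w) [] []) =
      P.transducing .seek (inputAt (w.reverse ++ u) []) [] [] := by
  induction w generalizing u with
  | nil => rfl
  | cons x w ih =>
    rw [List.length_cons, Function.iterate_succ_apply,
      P.step_transducing (x := some x) (by simp [inputAt, Tape.mk₂]) fun _ _ => rfl]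
    convert ih (x :: u) using 2
    · simp [act, inputAt, Tape.mk₂]
    · simp

theorem iterate_emit (x : α) (s : P.S) (i : ℕ) (hi : i < P.maxLen + 1) (T o₁ o₂) :
    P.typedMachine.step^[i] (P.transducing (.emit x s ⟨i, hi⟩) T
        ((P.out₁ x s).drop i ++ o₁) ((P.out₂ x s).drop i ++ o₂)) =
      P.transducing (.emit x s 0) T (P.out₁ x s ++ o₁) (P.out₂ x s ++ o₂) := by
  induction i with
  | zero => rfl
  | succ i ih =>
    rw [Function.iterate_succ_apply, P.step_transducing rfl fun _ _ => rfl]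
    convert ih (Nat.lt_of_succ_lt hi) using 2
    simp [act, ← List.append_assoc, ← List.drop_eq_getElem?_toList_append]

/-- The configuration in which the transducer has read `w` and has still to read the word `u`, which
is in reversed order. -/
noncomputable def reading (u w : List α) : P.typedMachine.Cfg :=
  P.transducing (.read (w.foldr P.next P.init)) ((inputAt u w).move .left) (P.output₁ w)
    (P.output₂ w)

theorem iterate_reading_cons (x : α) (u w : List α) :
    P.typedMachine.step^[P.maxLen + 2] (P.reading (x :: u) w) = P.reading u (x :: w) := by
  have read : P.typedMachine.step (P.reading (x :: u) w) =
      P.transducing (.emit x (w.foldr P.next P.init) (Fin.last _))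
        ((inputAt u (x :: w)).move .left) (P.output₁ w) (P.output₂ w) := by
    rw [reading, P.step_transducing (x := some x) (by simp [inputAt, Tape.mk₂]) fun _ _ => rfl]
    simp [act, inputAt, Tape.mk₂]
  have emit := P.iterate_emit x (w.foldr P.next P.init) P.maxLen (Nat.lt_succ_self _)
    ((inputAt u (x :: w)).move .left) (P.output₁ w) (P.output₂ w)
  rw [List.drop_of_length_le (P.length_out₁_le _ _), List.drop_of_length_le (P.length_out₂_le _ _)]
    at emit
  rw [Function.iterate_succ_apply, read, Function.iterate_succ_apply']
  refine (congrArg _ emit).trans ?_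
  rw [P.step_transducing rfl fun _ _ => rfl]
  simp [act, reading, output₁, output₂, transduce]

theorem iterate_reading (u w : List α) :
    P.typedMachine.step^[(P.maxLen + 2) * u.length] (P.reading u w) =
      P.reading [] (u.reverse ++ w) := by
  induction u generalizing w with
  | nil => rfl
  | cons x u ih =>
    rw [List.length_cons, mul_add_one, Function.iterate_add_apply, iterate_reading_cons, ih]
    simp

/-- The configuration in which `M₁` and `M₂` are in the given configurations. -/
noncomputable def running (T : Tape (Option (Fin (Nat.card α)))) (c₁ : P.M₁.Cfg) (c₂ : P.M₂.Cfg) :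
    P.typedMachine.Cfg :=
  P.cfg (P.verdict c₁.state c₂.state) T c₁.tape c₂.tape

theorem step_running (T) (c₁ : P.M₁.Cfg) (c₂ : P.M₂.Cfg) {q : P.Q}
    (h : P.verdict c₁.state c₂.state = Sum.inl q) :
    P.typedMachine.step (P.running T c₁ c₂) = P.running T (P.M₁.step c₁) (P.M₂.step c₂) := by
  rw [running, h, P.verdict_eq_inl h, P.step_cfg rfl rfl, running, MultiTapeTM.step_eq_trans,
    MultiTapeTM.step_eq_trans]
  simp

theorem state_iterate_running (t : ℕ) (T) (c₁ : P.M₁.Cfg) (c₂ : P.M₂.Cfg) :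
    (P.typedMachine.step^[t] (P.running T c₁ c₂)).state =
      P.verdict (P.M₁.step^[t] c₁).state (P.M₂.step^[t] c₂).state := by
  induction t generalizing c₁ c₂ with
  | zero => rfl
  | succ t ih =>
    rw [Function.iterate_succ_apply, Function.iterate_succ_apply, Function.iterate_succ_apply, ← ih]
    cases h : P.verdict c₁.state c₂.state with
    | inl q => rw [P.step_running T c₁ c₂ h]
    | inr b =>
      have halted : (P.running T c₁ c₂).state = Sum.inr b := h
      have halted' : (P.running T (P.M₁.step c₁) (P.M₂.step c₂)).state = Sum.inr b :=
        P.verdict_step h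
      rw [TypedTapeTM.step_of_halt _ halted,
        Function.iterate_fixed (TypedTapeTM.step_of_halt _ halted),
        Function.iterate_fixed (TypedTapeTM.step_of_halt _ halted'), halted, halted']

theorem iterate_prepTime (w : List α) :
    P.typedMachine.step^[P.prepTime w] (P.typedMachine.init w) =
      P.cfg (if P.acc (w.foldr P.next P.init) then
          P.verdict (Sum.inl P.M₁.start) (Sum.inl P.M₂.start) else Sum.inr false)
        ((inputAt [] w).move .left) (P.M₁.init (P.output₁ w)).tape
        (P.M₂.init (P.output₂ w)).tape := by
  have seek : P.typedMachine.step^[w.length] (P.typedMachine.init w) =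
      P.transducing .seek (inputAt w.reverse []) [] [] := by
    rw [init_eq, iterate_seek, List.append_nil]
  have turn : P.typedMachine.step (P.transducing .seek (inputAt w.reverse []) [] []) =
      P.reading w.reverse [] := by
    rw [P.step_transducing (x := none) rfl fun _ _ => rfl]
    simp [act, reading, output₁, output₂, transduce]
  have read : P.typedMachine.step^[(P.maxLen + 2) * w.length] (P.reading w.reverse []) =
      P.reading [] w := by
    rw [← List.length_reverse, iterate_reading, List.reverse_reverse, List.append_nil]
  have at_left_end : ((inputAt [] w).move .left).head = none := by
    simp [inputAt, Tape.mk₂]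
    rfl
  have enter : P.typedMachine.step (P.reading [] w) = _ := P.step_cfg
    (x := none) (by rw [at_left_end]; rfl) rfl
  rw [prepTime, Function.iterate_add_apply, seek, Function.iterate_add_apply,
    Function.iterate_add_apply, Function.iterate_one, turn, read, enter, MultiTapeTM.act_enter,
    MultiTapeTM.act_enter]
  simp [act, verdict]

theorem state_run {w : List α} {t : ℕ} {b : Bool}
    (h : (if P.acc (w.foldr P.next P.init) then
      P.verdict (P.M₁.run (P.output₁ w) t).state (P.M₂.run (P.output₂ w) t).state
        else Sum.inr false) = Sum.inr b) :
    (P.machine.run w (P.prepTime w + t)).state = Sum.inr b := by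
  refine P.typedMachine.state_run_toMultiTapeTM_of_halt ?_
  rw [add_comm, Function.iterate_add_apply, iterate_prepTime]
  split_ifs at h ⊢ with hacc
  · exact (P.state_iterate_running t _ (P.M₁.init _) (P.M₂.init _)).trans h
  · rw [Function.iterate_fixed (TypedTapeTM.step_of_halt (b := false) _ rfl)]
    exact h

variable {P} {L₁ : Language β₁} {L₂ : Language β₂}

theorem time_le_of_reject (h₁ : P.M₁.Decides L₁) {w : List α}
    (hw : ¬(P.acc (w.foldr P.next P.init) ∧ P.output₁ w ∈ L₁)) :
    P.machine.time w ≤ P.prepTime w + P.M₁.time (P.output₁ w) := by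
  obtain ⟨t, b, ht, hb, hbL⟩ := h₁.exists_time_eq (P.output₁ w)
  rw [ht]
  refine mod_cast P.machine.time_le_of_halt (b := false) (P.state_run ?_)
  split_ifs with hacc
  · have : b = false := by simp_all
    rw [hb, this, verdict]
  · rfl

theorem exists_halt (h₁ : P.M₁.Decides L₁) (h₂ : P.M₂.Decides L₂) (w : List α) :
    ∃ (t : ℕ) (b : Bool), (P.machine.run w t).state = Sum.inr b ∧
      (b = true ↔ P.acc (w.foldr P.next P.init) ∧ P.output₁ w ∈ L₁ ∧ P.output₂ w ∈ L₂) ∧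
      (t : ℕ∞) = P.prepTime w + (P.M₁.time (P.output₁ w) + P.M₂.time (P.output₂ w)) := by
  obtain ⟨t₁, b₁, ht₁, hb₁, hL₁⟩ := h₁.exists_time_eq (P.output₁ w)
  obtain ⟨t₂, b₂, ht₂, hb₂, hL₂⟩ := h₂.exists_time_eq (P.output₂ w)
  refine ⟨P.prepTime w + (t₁ + t₂), P.acc (w.foldr P.next P.init) && (b₁ && b₂), P.state_run ?_,
    by simp [hL₁, hL₂], by simp [ht₁, ht₂]⟩
  rw [MultiTapeTM.run_of_halt _ hb₁ (Nat.le_add_right _ _), hb₁,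
    MultiTapeTM.run_of_halt _ hb₂ (Nat.le_add_left _ _), hb₂]
  cases b₁ <;> cases h : P.acc (w.foldr P.next P.init) <;> simp [verdict]

theorem decides (h₁ : P.M₁.Decides L₁) (h₂ : P.M₂.Decides L₂) :
    P.machine.Decides
      {w | P.acc (w.foldr P.next P.init) ∧ P.output₁ w ∈ L₁ ∧ P.output₂ w ∈ L₂} := fun w =>
  have ⟨t, b, hb, hL, _⟩ := exists_halt h₁ h₂ w
  ⟨t, b, hb, hL⟩

theorem time_le (h₁ : P.M₁.Decides L₁) (h₂ : P.M₂.Decides L₂) (w : List α) :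
    P.machine.time w ≤
      P.prepTime w + (P.M₁.time (P.output₁ w) + P.M₂.time (P.output₂ w)) := by
  obtain ⟨t, b, hb, -, ht⟩ := exists_halt h₁ h₂ w
  exact ht ▸ P.machine.time_le_of_halt hb

end Pipeline

/-! ### Words and cocycles -/

section Words

variable {A G : Type*} [Group G] (π : A → G)

@[simp]
theorem wordVal_nil : wordVal π [] = 1 := rfl

@[simp]
theorem wordVal_cons (x : A × Bool) (w : List (A × Bool)) :
    wordVal π (x :: w) = letterVal π x * wordVal π w := by
  simp [wordVal]

@[simp]
theorem wordVal_append (v w : List (A × Bool)) :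
    wordVal π (v ++ w) = wordVal π v * wordVal π w := by
  simp [wordVal]

theorem letterVal_not (x : A × Bool) : letterVal π (x.1, !x.2) = (letterVal π x)⁻¹ := by
  obtain ⟨a, _ | _⟩ := x <;> simp [letterVal]

theorem exists_wordVal_eq_inv (w : List (A × Bool)) : ∃ v, wordVal π v = (wordVal π w)⁻¹ := by
  induction w with
  | nil => exact ⟨[], by simp⟩
  | cons x w ih =>
    obtain ⟨v, hv⟩ := ih
    exact ⟨v ++ [(x.1, !x.2)], by simp [hv, letterVal_not]⟩

theorem Generates.exists_wordVal_eq {π : A → G} (hπ : Generates π) (g : G) :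
    ∃ w, wordVal π w = g := by
  have hg : g ∈ Subgroup.closure (Set.range π) := by rw [hπ]; trivial
  induction hg using Subgroup.closure_induction with
  | mem x hx =>
    obtain ⟨a, rfl⟩ := hx
    exact ⟨[(a, true)], by simp [letterVal]⟩
  | one => exact ⟨[], rfl⟩
  | mul x y _ _ hx hy =>
    obtain ⟨v, rfl⟩ := hx
    obtain ⟨w, rfl⟩ := hy
    exact ⟨v ++ w, by simp⟩
  | inv x _ hx =>
    obtain ⟨v, rfl⟩ := hx
    exact exists_wordVal_eq_inv π v

theorem foldr_letterVal_smul {C : Type*} [MulAction G C] (c₀ : C) (w : List (A × Bool)) :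
    w.foldr (fun x c => letterVal π x • c) c₀ = wordVal π w • c₀ := by
  induction w with
  | nil => simp
  | cons x w ih => rw [List.foldr_cons, ih, wordVal_cons, mul_smul]

end Words

/-- A cocycle of an action of `G` on `C` with values in the group `Γ`. -/
structure ActionCocycle (G C Γ : Type*) [Group G] [MulAction G C] [Group Γ] where
  toFun : G → C → Γ
  map_mul' : ∀ g h c, toFun (g * h) c = toFun g (h • c) * toFun h c

namespace ActionCocycle

variable {G C Γ Δ : Type*} [Group G] [MulAction G C] [Group Γ] [Group Δ]

instance : CoeFun (ActionCocycle G C Γ) fun _ => G → C → Γ := ⟨toFun⟩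

theorem map_mul (r : ActionCocycle G C Γ) (g h : G) (c : C) :
    r (g * h) c = r g (h • c) * r h c :=
  r.map_mul' g h c

@[simp]
theorem map_one (r : ActionCocycle G C Γ) (c : C) : r 1 c = 1 := by
  simpa using r.map_mul 1 1 c

/-- The composition of a cocycle with a homomorphism. -/
def map (r : ActionCocycle G C Γ) (f : Γ →* Δ) : ActionCocycle G C Δ where
  toFun g c := f (r g c)
  map_mul' g h c := by rw [r.map_mul, _root_.map_mul]

theorem map_apply (r : ActionCocycle G C Γ) (f : Γ →* Δ) (g : G) (c : C) :
    r.map f g c = f (r g c) := rfl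

/-- A homomorphism as a cocycle that does not depend on the point. -/
def ofHom (C : Type*) [MulAction G C] (f : G →* Γ) : ActionCocycle G C Γ where
  toFun g _ := f g
  map_mul' g h _ := f.map_mul g h

/-- Coset representatives for a subgroup, with `1` representing the subgroup itself. -/
noncomputable def cosetRep (G₁ : Subgroup G) : G ⧸ G₁ → G := by
  classical exact Function.update Quotient.out ((1 : G) : G ⧸ G₁) 1

@[simp]
theorem mk_cosetRep {G₁ : Subgroup G} (c : G ⧸ G₁) : ((cosetRep G₁ c : G) : G ⧸ G₁) = c := by
  obtain rfl | hc := eq_or_ne c ((1 : G) : G ⧸ G₁)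
  · simp [cosetRep]
  · simp [cosetRep, hc]

@[simp]
theorem cosetRep_one (G₁ : Subgroup G) : cosetRep G₁ ((1 : G) : G ⧸ G₁) = 1 := by
  simp [cosetRep]

/-- The cocycle `(g, c) ↦ t (g c)⁻¹ g t c` of the Reidemeister–Schreier rewriting process for
coset representatives `t`, which restricts to the identity on the stabilizer of the coset `1`. -/
noncomputable def schreier (G₁ : Subgroup G) : ActionCocycle G (G ⧸ G₁) G₁ where
  toFun g c := ⟨(cosetRep G₁ (g • c))⁻¹ * (g * cosetRep G₁ c), QuotientGroup.eq.1 <| by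
    rw [mk_cosetRep]
    exact congrArg (g • ·) (mk_cosetRep c).symm⟩
  map_mul' g h c := Subtype.ext <| by simp [mul_smul, mul_assoc]

theorem coe_schreier {G₁ : Subgroup G} (g : G) (c : G ⧸ G₁) :
    (schreier G₁ g c : G) = (cosetRep G₁ (g • c))⁻¹ * (g * cosetRep G₁ c) := rfl

theorem smul_coset_one_eq_iff {G₁ : Subgroup G} {g : G} :
    g • ((1 : G) : G ⧸ G₁) = ((1 : G) : G ⧸ G₁) ↔ g ∈ G₁ := by
  rw [← MulAction.mem_stabilizer_iff, MulAction.stabilizer_quotient]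

theorem schreier_coset_one {G₁ : Subgroup G} (g : G₁) :
    schreier G₁ (g : G) ((1 : G) : G ⧸ G₁) = g := by
  ext
  rw [coe_schreier, smul_coset_one_eq_iff.2 g.2]
  simp

theorem exists_schreier_eq {G₁ : Subgroup G} (c : G ⧸ G₁) (γ : G₁) :
    ∃ g : G, g • c = c ∧ schreier G₁ g c = γ := by
  have hfix : (cosetRep G₁ c * γ * (cosetRep G₁ c)⁻¹) • c = c := by
    have base : (cosetRep G₁ c)⁻¹ • c = ((1 : G) : G ⧸ G₁) := by
      rw [inv_smul_eq_iff]
      simp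
    rw [mul_smul, base, mul_smul, smul_coset_one_eq_iff.2 γ.2, ← base, smul_inv_smul]
  refine ⟨_, hfix, Subtype.ext ?_⟩
  rw [coe_schreier, hfix]
  group

/-- The skew product of the `G`-set `C` with a `Γ`-set `U` along a cocycle. -/
@[nolint unusedArguments]
def SkewProduct (_ : ActionCocycle G C Γ) (U : Type*) : Type _ := C × U

instance (r : ActionCocycle G C Γ) (U : Type*) [MulAction Γ U] :
    MulAction G (r.SkewProduct U) where
  smul g p := (g • p.1, r g p.1 • p.2)
  one_smul p := Prod.ext (one_smul _ _) (by
    change r 1 p.1 • p.2 = p.2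
    rw [map_one, one_smul])
  mul_smul g h p := Prod.ext (mul_smul _ _ _) (by
    change r (g * h) p.1 • p.2 = r g (h • p.1) • r h p.1 • p.2
    rw [map_mul, mul_smul])

/-- A point of the skew product. -/
def point (r : ActionCocycle G C Γ) {U : Type*} (c : C) (u : U) : r.SkewProduct U := (c, u)

theorem smul_point (r : ActionCocycle G C Γ) {U : Type*} [MulAction Γ U] (g : G) (c : C) (u : U) :
    g • r.point c u = r.point (g • c) (r g c • u) := rfl

theorem point_inj {r : ActionCocycle G C Γ} {U : Type*} {c c' : C} {u u' : U} :
    r.point c u = r.point c' u' ↔ c = c' ∧ u = u' :=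
  Prod.ext_iff

theorem mem_stabilizer_point {r : ActionCocycle G C Γ} {K : Subgroup Γ} {g : G} {c : C} :
    g ∈ MulAction.stabilizer G (r.point c ((1 : Γ) : Γ ⧸ K)) ↔ g • c = c ∧ r g c ∈ K := by
  rw [MulAction.mem_stabilizer_iff, smul_point, point_inj, smul_coset_one_eq_iff]

theorem exists_transduce_eq {A B : Type*} [Finite A] [Finite C] (r : ActionCocycle G C Γ)
    (π : A → G) {ρ : B → Γ} (hρ : Generates ρ) :
    ∃ (out : A × Bool → C → List (B × Bool)) (k : ℕ), (∀ x c, (out x c).length ≤ k) ∧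
      ∀ c w, wordVal ρ (transduce (fun x c => letterVal π x • c) out c w) = r (wordVal π w) c := by
  choose out hout using fun x c => hρ.exists_wordVal_eq (r (letterVal π x) c)
  obtain ⟨k, hk⟩ := (Set.finite_range fun p : (A × Bool) × C => (out p.1 p.2).length).bddAbove
  refine ⟨out, k, fun x c => hk ⟨(x, c), rfl⟩, fun c w => ?_⟩
  induction w with
  | nil => simp [transduce]
  | cons x w ih =>
    rw [transduce, wordVal_append, ih, hout, foldr_letterVal_smul, wordVal_cons, map_mul]

end ActionCocycle

/-! ### A machine for the membership problem -/

theorem exists_machine_membershipProblem {G C Γ A B₁ B₂ : Type*} [Group G] [MulAction G C]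
    [Group Γ] [Finite A] [Finite C] (r : ActionCocycle G C Γ) (c₀ : C) {π : A → G}
    {ρ₁ : B₁ → Γ} (hρ₁ : Generates ρ₁) {ρ₂ : B₂ → G} (hρ₂ : Generates ρ₂)
    {K : Subgroup Γ} {H : Subgroup G}
    (hH : H ≤ MulAction.stabilizer G (r.point c₀ ((1 : Γ) : Γ ⧸ K))) {f g : ℕ → ℕ}
    (hf : Monotone f) (hg : Monotone g) (hK : DecidableInTime (membershipProblem ρ₁ K) f)
    (hHg : DecidableInTime (membershipProblem ρ₂ H) g) :
    ∃ N : MultiTapeTM (A × Bool), N.Decides (membershipProblem π H) ∧ ∃ k : ℕ, ∀ w,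
      N.time w ≤ ((k * (w.length + 1) + f (k * w.length) + g (k * w.length) : ℕ) : ℕ∞) ∧
      (wordVal π w ∉ MulAction.stabilizer G (r.point c₀ ((1 : Γ) : Γ ⧸ K)) →
        N.time w ≤ ((k * (w.length + 1) + f (k * w.length) : ℕ) : ℕ∞)) := by
  classical
  obtain ⟨M₁, hM₁, htime₁⟩ := hK
  obtain ⟨M₂, hM₂, htime₂⟩ := hHg
  obtain ⟨out₁, k₁, hk₁, hout₁⟩ := r.exists_transduce_eq π hρ₁
  obtain ⟨out₂, k₂, hk₂, hout₂⟩ :=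
    (ActionCocycle.ofHom C (MonoidHom.id G)).exists_transduce_eq π hρ₂
  let P : Pipeline (A × Bool) (B₁ × Bool) (B₂ × Bool) :=
    { M₁, M₂, S := C, finS := ‹_›, init := c₀, next x c := letterVal π x • c, out₁, out₂
      acc c := c = c₀, maxLen := max k₁ k₂
      length_out₁_le x c := (hk₁ x c).trans (le_max_left ..)
      length_out₂_le x c := (hk₂ x c).trans (le_max_right ..) }
  have maxLen_le : P.maxLen ≤ P.maxLen + 3 := Nat.le_add_right _ _
  have time₁_le := P.time_output₁_le hf htime₁ maxLen_le
  have time₂_le := P.time_output₂_le hg htime₂ maxLen_le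
  have stabilizes_iff (w) : P.acc (w.foldr P.next P.init) ∧ P.output₁ w ∈ membershipProblem ρ₁ K ↔
      wordVal π w ∈ MulAction.stabilizer G (r.point c₀ ((1 : Γ) : Γ ⧸ K)) := by
    rw [ActionCocycle.mem_stabilizer_point, ← hout₁, ← foldr_letterVal_smul]
    exact and_congr_left' decide_eq_true_iff
  refine ⟨P.machine, ?_, P.maxLen + 3, fun w => ⟨?_, fun hw => ?_⟩⟩
  · have lang_eq : membershipProblem π H = {w | P.acc (w.foldr P.next P.init) ∧
        P.output₁ w ∈ membershipProblem ρ₁ K ∧ P.output₂ w ∈ membershipProblem ρ₂ H} := by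
      refine Set.ext fun w => (?_ : wordVal π w ∈ H ↔ _ ∧ _ ∧ wordVal ρ₂ (P.output₂ w) ∈ H)
      rw [← and_assoc, stabilizes_iff, show wordVal ρ₂ (P.output₂ w) = wordVal π w from hout₂ c₀ w]
      exact (and_iff_right_of_imp (hH ·)).symm
    exact lang_eq ▸ Pipeline.decides (P := P) hM₁ hM₂
  · refine (Pipeline.time_le (P := P) hM₁ hM₂ w).trans ?_
    push_cast
    rw [add_assoc]
    exact add_le_add (mod_cast P.prepTime_le w) (add_le_add (time₁_le w) (time₂_le w))
  · refine (Pipeline.time_le_of_reject (P := P) hM₁ (mt (stabilizes_iff w).1 hw)).trans ?_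
    push_cast
    exact add_le_add (mod_cast P.prepTime_le w) (time₁_le w)

/-! ### Expansion -/

open Classical in
/-- The number of points of `F` that `g` moves out of `F`. -/
noncomputable def leaving {G V : Type*} [Group G] [MulAction G V] (g : G) (F : Finset V) : ℕ :=
  (F.filter fun v => g • v ∉ F).card

/-- The family `s` of elements of `G` moves, counted with multiplicity, at least `ε * |F|` points of
each finite subset `F` of `V` out of it. For the letters of a generating set this is the
isoperimetric inequality of the Schreier graph of the action. -/
def Expands {G X : Type*} (V : Type*) [Group G] [MulAction G V] [Fintype X] (s : X → G)
    (ε : ℝ) : Prop :=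
  ∀ F : Finset V, ε * (F.card : ℝ) ≤ ((∑ x, leaving (s x) F : ℕ) : ℝ)

section Expansion

variable {G : Type*} [Group G]

section Leaving

variable {V : Type*} [MulAction G V]

theorem leaving_one (F : Finset V) : leaving (1 : G) F = 0 := by
  simp [leaving, Finset.filter_eq_empty_iff]

theorem leaving_mul_le (g h : G) (F : Finset V) :
    leaving (g * h) F ≤ leaving g F + leaving h F := by
  classical
  have subset : (F.filter fun v => (g * h) • v ∉ F) ⊆
      ((F.filter fun v => g • v ∉ F).image (h⁻¹ • ·)) ∪ (F.filter fun v => h • v ∉ F) := by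
    intro v hv
    simp only [Finset.mem_filter, Finset.mem_union, Finset.mem_image] at hv ⊢
    by_cases hh : h • v ∈ F
    · exact Or.inl ⟨h • v, ⟨hh, by simpa [mul_smul] using hv.2⟩, by simp⟩
    · exact Or.inr ⟨hv.1, hh⟩
  refine (Finset.card_le_card subset).trans ((Finset.card_union_le _ _).trans ?_)
  exact Nat.add_le_add_right Finset.card_image_le _

theorem leaving_wordVal_le {A : Type*} [Fintype A] (π : A → G) (w : List (A × Bool))
    (F : Finset V) :
    leaving (wordVal π w) F ≤ w.length * ∑ x, leaving (letterVal π x) F := by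
  induction w with
  | nil => simp [leaving_one]
  | cons x w ih =>
    rw [wordVal_cons, List.length_cons, add_mul, one_mul, add_comm]
    refine (leaving_mul_le _ _ _).trans (add_le_add ?_ ih)
    exact Finset.single_le_sum (f := fun x => leaving (letterVal π x) F) (fun _ _ => Nat.zero_le _)
      (Finset.mem_univ x)

theorem Expands.of_generates {Y A : Type*} [Fintype Y] [Fintype A] {s : Y → G} {ε : ℝ} (hε : 0 < ε)
    (h : Expands V s ε) {π : A → G} (hπ : Generates π) :
    ∃ δ : ℝ, 0 < δ ∧ Expands V (letterVal π) δ := by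
  choose w hw using fun y => hπ.exists_wordVal_eq (s y)
  set m := ∑ y, (w y).length with hm
  refine ⟨ε / (m + 1), by positivity, fun F => ?_⟩
  rw [div_mul_eq_mul_div, div_le_iff₀ (by positivity)]
  refine (h F).trans ?_
  norm_cast
  calc ∑ y, leaving (s y) F ≤ ∑ y, (w y).length * ∑ x, leaving (letterVal π x) F :=
        Finset.sum_le_sum fun y _ => by
          rw [← hw y]; exact leaving_wordVal_le π (w y) F
    _ = m * ∑ x, leaving (letterVal π x) F := by rw [hm, Finset.sum_mul]
    _ ≤ (∑ x, leaving (letterVal π x) F) * (m + 1) := by rw [mul_comm]; gcongr; omega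

end Leaving

/-- Inversion identifies right cosets with left cosets. -/
def rightCosetsEquiv (K : Subgroup G) : RightCosets K ≃ G ⧸ K :=
  QuotientGroup.quotientRightRelEquivQuotientLeftRel K

theorem rightCosetsEquiv_translate {K : Subgroup G} (x : G) (v : RightCosets K) :
    rightCosetsEquiv K (RightCosets.translate K x v) = x⁻¹ • rightCosetsEquiv K v := by
  induction v using Quotient.inductionOn with
  | h g =>
    change (((g * x)⁻¹ : G) : G ⧸ K) = x⁻¹ • ((g⁻¹ : G) : G ⧸ K)
    rw [mul_inv_rev]
    rfl

theorem ncard_schreierBoundary_le {A : Type*} [Fintype A] (π : A → G) {K : Subgroup G}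
    (F : Finset (G ⧸ K)) :
    (schreierBoundary π (rightCosetsEquiv K ⁻¹' F)).ncard ≤ ∑ x, leaving (letterVal π x) F := by
  classical
  let B : Finset (Sigma fun _ : A × Bool => G ⧸ K) :=
    Finset.univ.sigma fun x => F.filter fun v => letterVal π x • v ∉ F
  have card_B : B.card = ∑ x, leaving (letterVal π x) F := by
    rw [Finset.card_sigma]
    exact Finset.sum_congr rfl fun x _ => by unfold leaving; congr
  rw [← card_B, ← Set.ncard_coe_finset B]
  refine Set.ncard_le_ncard_of_injOn (fun e => ⟨(e.2.1, !e.2.2), rightCosetsEquiv K e.1⟩) ?_ ?_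
    B.finite_toSet
  · rintro ⟨v, x⟩ ⟨hv, hx⟩
    simp only [B, Finset.coe_sigma, Set.mem_sigma_iff, Finset.coe_univ, Set.mem_univ, true_and,
      Finset.coe_filter, Set.mem_ofPred_eq, letterVal_not]
    rw [← rightCosetsEquiv_translate]
    exact ⟨hv, hx⟩
  · rintro ⟨v, x, b⟩ - ⟨v', x', b'⟩ - h
    simpa [and_comm, and_assoc] using h

theorem SchreierNonamenable.exists_expands {A : Type*} [Fintype A] {π : A → G} {K : Subgroup G}
    (h : SchreierNonamenable π K) : ∃ ε : ℝ, 0 < ε ∧ Expands (G ⧸ K) (letterVal π) ε := by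
  obtain ⟨ε, hε, h⟩ := h
  refine ⟨ε, hε, fun F => ?_⟩
  obtain rfl | hF := F.eq_empty_or_nonempty
  · simp only [Finset.card_empty, Nat.cast_zero, mul_zero]
    positivity
  have card_preimage : ((rightCosetsEquiv K ⁻¹' F : Set _).ncard : ℝ) = F.card := by
    rw [Set.ncard_preimage_of_injective_subset_range (rightCosetsEquiv K).injective (by simp),
      Set.ncard_coe_finset]
  rw [← card_preimage]
  exact (h _ (F.finite_toSet.preimage (rightCosetsEquiv K).injective.injOn)
    (hF.to_set.preimage (rightCosetsEquiv K).surjective)).trans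
      (mod_cast ncard_schreierBoundary_le π F)

theorem Expands.skewProduct {C Γ U X : Type*} [Group Γ] [MulAction G C] [Fintype C]
    [MulAction Γ U] [Fintype X] {s : X → Γ} {ε : ℝ} (h : Expands U s ε) (r : ActionCocycle G C Γ)
    (hr : ∀ c γ, ∃ g : G, g • c = c ∧ r g c = γ) :
    ∃ s' : C × X → G, Expands (r.SkewProduct U) s' ε := by
  classical
  choose g hg hrg using hr
  refine ⟨fun p => g p.1 (s p.2), fun F => ?_⟩
  let fiber (c : C) : Finset U := F.preimage (r.point c) fun _ _ _ _ => fun h => (r.point_inj.1 h).2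
  have mem_fiber {c u} : u ∈ fiber c ↔ r.point c u ∈ F := Finset.mem_preimage
  have card_F : F.card = ∑ c, (fiber c).card := by
    rw [← Finset.card_sigma]
    refine (Finset.card_bij (fun p _ => r.point p.1 p.2) (fun p hp => ?_) ?_ fun p hp => ?_).symm
    · simpa [mem_fiber] using hp
    · rintro ⟨c, u⟩ - ⟨c', u'⟩ - h
      simpa using r.point_inj.1 h
    · exact ⟨⟨p.1, p.2⟩, Finset.mem_sigma.2 ⟨Finset.mem_univ _, mem_fiber.2 hp⟩, rfl⟩
  have leaving_fiber_le (c x) : leaving (s x) (fiber c) ≤ leaving (g c (s x)) F := by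
    refine Finset.card_le_card_of_injOn (r.point c) (fun u hu => ?_)
      fun _ _ _ _ h => (r.point_inj.1 h).2
    simpa [mem_fiber, r.smul_point, hg, hrg] using hu
  calc ε * F.card = ∑ c, ε * (fiber c).card := by rw [card_F]; push_cast; rw [Finset.mul_sum]
    _ ≤ ∑ c, ((∑ x, leaving (s x) (fiber c) : ℕ) : ℝ) := Finset.sum_le_sum fun c _ => h _
    _ ≤ _ := by
      rw [Fintype.sum_prod_type]
      exact_mod_cast Finset.sum_le_sum fun c _ => Finset.sum_le_sum fun x _ => leaving_fiber_le c x

end Expansion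

/-! ### The spectral gap -/

section CoArea

open MeasureTheory

variable {G V : Type*} [Group G] [MulAction G V]

theorem sum_smul_eq {M : Type*} [AddCommMonoid M] {S : Finset V} {g : G} {k : V → M}
    (hk : ∀ v ∉ S, k v = 0) (hgk : ∀ v ∉ S, k (g • v) = 0) :
    ∑ v ∈ S, k (g • v) = ∑ v ∈ S, k v := by
  rw [← finsum_eq_sum_of_support_subset _ (fun v hv => by_contra fun hS => hv (hk v hS)),
    ← finsum_eq_sum_of_support_subset _ (fun v hv => by_contra fun hS => hv (hgk v hS))]
  exact finsum_comp_equiv (MulAction.toPerm g)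

theorem exists_finset_forall_smul_eq_zero {X M : Type*} [Finite X] [Zero M] (s : X → G)
    (f : V →₀ M) : ∃ S : Finset V, ∀ v ∉ S, f v = 0 ∧ ∀ x, f (s x • v) = 0 := by
  have finite : (f.support ∪ ⋃ x, (s x • ·) ⁻¹' f.support : Set V).Finite :=
    f.support.finite_toSet.union <| Set.finite_iUnion fun x =>
      f.support.finite_toSet.preimage (MulAction.injective (s x)).injOn
  refine ⟨finite.toFinset, fun v hv => ?_⟩
  simpa using hv

variable {X : Type*} [Fintype X] {s : X → G} {ε : ℝ}

theorem leaving_superlevel (g : G) {S : Finset V} {h : V → ℝ} (hS : ∀ v ∉ S, h v = 0) {t : ℝ}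
    (ht : 0 ≤ t) : (leaving g (S.filter (t < h ·)) : ℝ) =
      ∑ v ∈ S, (Set.Ico (h (g • v)) (h v)).indicator 1 t := by
  classical
  have mem_iff (v) : g • v ∈ S.filter (t < h ·) ↔ t < h (g • v) := by
    refine ⟨fun hv => (Finset.mem_filter.1 hv).2, fun hv => Finset.mem_filter.2 ⟨?_, hv⟩⟩
    exact by_contra fun hgv => (hS _ hgv ▸ hv).not_ge ht
  rw [leaving, Finset.filter_filter, ← Finset.sum_boole]
  simp [mem_iff, Set.indicator_apply, and_comm]

/-- The co-area inequality: integrate the expansion of the superlevel sets of `h`. -/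
theorem Expands.mul_sum_le (hs : Expands V s ε) {S : Finset V} {h : V → ℝ} (h0 : ∀ v, 0 ≤ h v)
    (hS : ∀ v ∉ S, h v = 0) :
    ε * ∑ v ∈ S, h v ≤ ∑ x, ∑ v ∈ S, (h v - h (s x • v))⁺ := by
  have level (t : ℝ) : ε * ∑ v ∈ S, (Set.Ico 0 (h v)).indicator 1 t ≤
      ∑ x, ∑ v ∈ S, (Set.Ico (h (s x • v)) (h v)).indicator 1 t := by
    obtain ht | ht := le_or_gt 0 t
    · have := hs (S.filter (t < h ·))
      push_cast [leaving_superlevel _ hS ht] at this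
      simpa [Set.indicator_apply, ht] using this
    · simp [ht.not_ge, fun v => (ht.trans_le (h0 v)).not_ge]
  have integrable (a b : ℝ) : Integrable ((Set.Ico a b).indicator (1 : ℝ → ℝ)) :=
    (integrable_indicator_iff measurableSet_Ico).2 (integrableOn_const (by simp))
  have integral_eq (a b : ℝ) : ∫ t, (Set.Ico a b).indicator 1 t = (b - a)⁺ :=
    (integral_indicator_one measurableSet_Ico).trans Real.volume_real_Ico
  calc ε * ∑ v ∈ S, h v = ∫ t, ε * ∑ v ∈ S, (Set.Ico 0 (h v)).indicator 1 t := by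
        rw [integral_const_mul, integral_finsetSum _ fun _ _ => integrable _ _]
        simp [integral_eq, h0]
    _ ≤ ∫ t, ∑ x, ∑ v ∈ S, (Set.Ico (h (s x • v)) (h v)).indicator 1 t :=
        integral_mono
          ((integrable_finsetSum _ fun _ _ => integrable _ _).const_mul ε)
          (integrable_finsetSum _ fun _ _ => integrable_finsetSum _ fun _ _ => integrable _ _) level
    _ = ∑ x, ∑ v ∈ S, (h v - h (s x • v))⁺ := by
        rw [integral_finsetSum _ fun _ _ => integrable_finsetSum _ fun _ _ => integrable _ _]
        simp only [integral_finsetSum _ fun _ _ => integrable _ _, integral_eq]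

theorem Expands.two_mul_mul_sum_le (hs : Expands V s ε) {S : Finset V} {h : V → ℝ}
    (h0 : ∀ v, 0 ≤ h v) (hS : ∀ v ∉ S, h v = 0 ∧ ∀ x, h (s x • v) = 0) :
    2 * ε * ∑ v ∈ S, h v ≤ ∑ x, ∑ v ∈ S, |h v - h (s x • v)| := by
  calc 2 * ε * ∑ v ∈ S, h v ≤ 2 * ∑ x, ∑ v ∈ S, (h v - h (s x • v))⁺ := by
        rw [mul_assoc]
        gcongr
        exact hs.mul_sum_le h0 fun v hv => (hS v hv).1
    _ = ∑ x, ∑ v ∈ S, |h v - h (s x • v)| := by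
        rw [Finset.mul_sum]
        refine Finset.sum_congr rfl fun x _ => ?_
        have balance : ∑ v ∈ S, (h v - h (s x • v)) = 0 := by
          rw [Finset.sum_sub_distrib, sub_eq_zero,
            sum_smul_eq (fun v hv => (hS v hv).1) fun v hv => (hS v hv).2 x]
        rw [← sub_eq_zero, ← balance, Finset.mul_sum, ← Finset.sum_sub_distrib]
        refine Finset.sum_congr rfl fun v _ => ?_
        linarith [posPart_add_negPart (h v - h (s x • v)), posPart_sub_negPart (h v - h (s x • v))]

end CoArea

/-- The standard inner product of finitely supported real functions. -/
noncomputable def dot (V : Type*) : LinearMap.BilinForm ℝ (V →₀ ℝ) :=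
  Finsupp.linearCombination ℝ fun v => Finsupp.lapply v

theorem dot_eq_sum {V : Type*} {S : Finset V} {f g : V →₀ ℝ} (hf : ∀ v ∉ S, f v = 0) :
    dot V f g = ∑ v ∈ S, f v * g v := by
  rw [dot, Finsupp.linearCombination_apply, Finsupp.sum_of_support_subset f (s := S) _ _ (by simp)]
  · simp
  · exact fun v hv => by_contra fun hS => Finsupp.mem_support_iff.1 hv (hf v hS)

theorem dot_comm {V : Type*} (f g : V →₀ ℝ) : dot V f g = dot V g f := by
  classical
  rw [dot_eq_sum (S := f.support ∪ g.support) (by simp +contextual),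
    dot_eq_sum (S := f.support ∪ g.support) (by simp +contextual)]
  simp only [mul_comm]

theorem dot_self_nonneg {V : Type*} (f : V →₀ ℝ) : 0 ≤ dot V f f := by
  rw [dot_eq_sum (S := f.support) (by simp)]
  exact Finset.sum_nonneg fun v _ => mul_self_nonneg _

theorem sq_apply_le_dot_self {V : Type*} (f : V →₀ ℝ) (v : V) : f v ^ 2 ≤ dot V f f := by
  classical
  rw [dot_eq_sum (S := insert v f.support) (by simp +contextual), sq]
  exact Finset.single_le_sum (f := fun v => f v * f v) (fun v _ => mul_self_nonneg _) (by simp)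

section Walk

variable {G V X : Type*} [Group G] [MulAction G V] [Fintype X]

/-- The transition operator, without normalization, of the random walk on `V` with steps `s`. -/
noncomputable def walkOp (V : Type*) [MulAction G V] (s : X → G) : (V →₀ ℝ) →ₗ[ℝ] (V →₀ ℝ) :=
  ∑ x, Finsupp.lmapDomain ℝ ℝ (s x • ·)

theorem walkOp_apply (s : X → G) (f : V →₀ ℝ) (v : V) :
    walkOp V s f v = ∑ x, f ((s x)⁻¹ • v) := by
  simp only [walkOp, LinearMap.sum_apply, Finsupp.finsetSum_apply, Finsupp.lmapDomain_apply]
  refine Finset.sum_congr rfl fun x _ => ?_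
  conv_lhs => rw [← smul_inv_smul (s x) v]
  exact Finsupp.mapDomain_apply (MulAction.injective (s x)) _ _

theorem walkOp_single (s : X → G) (v : V) (a : ℝ) :
    walkOp V s (Finsupp.single v a) = ∑ x, Finsupp.single (s x • v) a := by
  simp [walkOp]

theorem dot_walkOp_left (s : X → G) {f : V →₀ ℝ} {S : Finset V} (hS : ∀ v ∉ S, f v = 0)
    (g : V →₀ ℝ) : dot V (walkOp V s f) g = ∑ x, ∑ v ∈ S, f v * g (s x • v) := by
  simp only [walkOp, LinearMap.sum_apply, map_sum]
  refine Finset.sum_congr rfl fun x _ => ?_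
  rw [dot, Finsupp.lmapDomain_apply, Finsupp.linearCombination_mapDomain,
    Finsupp.linearCombination_apply, Finsupp.sum_of_support_subset f (s := S) _ _ (by simp)]
  · simp
  · exact fun v hv => by_contra fun hS' => Finsupp.mem_support_iff.1 hv (hS v hS')

variable {s : X → G}

theorem dot_walkOp_comm {σ : X ≃ X} (hσ : ∀ x, s (σ x) = (s x)⁻¹) (f g : V →₀ ℝ) :
    dot V (walkOp V s f) g = dot V f (walkOp V s g) := by
  have hf : ∀ v ∉ f.support, f v = 0 := by simp
  rw [dot_walkOp_left s hf, dot_eq_sum hf, ← σ.sum_comp, Finset.sum_comm]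
  simp only [hσ, walkOp_apply, Finset.mul_sum]

/-- Cheeger's inequality: apply the co-area inequality to `f ^ 2` and the Cauchy–Schwarz inequality
to `|f v ^ 2 - f (s x • v) ^ 2| = |f v - f (s x • v)| * |f v + f (s x • v)|`. -/
theorem Expands.sq_dot_walkOp_le {ε : ℝ} (hs : Expands V s ε) (hε : 0 ≤ ε) (f : V →₀ ℝ) :
    dot V (walkOp V s f) f ^ 2 ≤ ((Fintype.card X : ℝ) ^ 2 - ε ^ 2) * dot V f f ^ 2 := by
  obtain ⟨S, hS⟩ := exists_finset_forall_smul_eq_zero s f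
  have hf v (hv : v ∉ S) : f v = 0 := (hS v hv).1
  set d := (Fintype.card X : ℝ)
  set b := dot V f f with hb
  set q := dot V (walkOp V s f) f
  have sum_sq : ∑ v ∈ S, f v ^ 2 = b := by simp only [hb, dot_eq_sum hf, sq]
  have sum_sq_smul (x) : ∑ v ∈ S, f (s x • v) ^ 2 = b := by
    rw [← sum_sq, sum_smul_eq (k := fun v => f v ^ 2)]
    · exact fun v hv => by simp [hf v hv]
    · exact fun v hv => by simp [(hS v hv).2 x]
  have sum_mul_smul : ∑ x, ∑ v ∈ S, f v * f (s x • v) = q := (dot_walkOp_left s hf f).symm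
  have sum_sub : ∑ p ∈ Finset.univ ×ˢ S, (f p.2 - f (s p.1 • p.2)) ^ 2 = 2 * (d * b - q) := by
    simp only [Finset.sum_product, sub_sq, Finset.sum_add_distrib, Finset.sum_sub_distrib,
      mul_assoc, ← Finset.mul_sum, sum_sq, sum_sq_smul, sum_mul_smul, Finset.sum_const,
      Finset.card_univ, nsmul_eq_mul]
    ring
  have sum_add : ∑ p ∈ Finset.univ ×ˢ S, (f p.2 + f (s p.1 • p.2)) ^ 2 = 2 * (d * b + q) := by
    simp only [Finset.sum_product, add_sq, Finset.sum_add_distrib, mul_assoc,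
      ← Finset.mul_sum, sum_sq, sum_sq_smul, sum_mul_smul, Finset.sum_const, Finset.card_univ,
      nsmul_eq_mul]
    ring
  have coarea : 2 * ε * b ≤ ∑ p ∈ Finset.univ ×ˢ S,
      |f p.2 - f (s p.1 • p.2)| * |f p.2 + f (s p.1 • p.2)| := by
    have := hs.two_mul_mul_sum_le (h := fun v => f v ^ 2) (fun v => sq_nonneg _) (S := S)
      fun v hv => by simpa using hS v hv
    simpa only [sum_sq, Finset.sum_product, ← abs_mul, sq_sub_sq, mul_comm] using this
  have cauchy_schwarz := Finset.sum_mul_sq_le_sq_mul_sq (Finset.univ ×ˢ S)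
    (fun p => |f p.2 - f (s p.1 • p.2)|) (fun p => |f p.2 + f (s p.1 • p.2)|)
  simp only [sq_abs, sum_sub, sum_add] at cauchy_schwarz
  have b_nonneg : 0 ≤ b := dot_self_nonneg f
  linarith [(pow_le_pow_left₀ (by positivity) coarea 2).trans cauchy_schwarz]

theorem apply_apply_le_of_abs_apply_le {E : Type*} [AddCommGroup E] [Module ℝ E]
    {B : LinearMap.BilinForm ℝ E} (comm : ∀ x y, B x y = B y x) (nonneg : ∀ x, 0 ≤ B x x)
    {T : E →ₗ[ℝ] E} (symm : ∀ x y, B (T x) y = B x (T y)) {c : ℝ}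
    (h : ∀ x, |B (T x) x| ≤ c * B x x) (x : E) : B (T x) (T x) ≤ c ^ 2 * B x x := by
  have polarized (t : ℝ) :
      0 ≤ c * B (T x) (T x) * (t * t) + -2 * B (T x) (T x) * t + c * B x x := by
    have plus := (abs_le.1 (h (x + t • T x))).2
    have minus := (abs_le.1 (h (x - t • T x))).1
    simp only [map_add, map_sub, map_smul, LinearMap.add_apply, LinearMap.sub_apply,
      LinearMap.smul_apply, smul_eq_mul] at plus minus
    rw [symm (T x) x, comm x (T x)] at *
    nlinarith
  have discriminant := discrim_le_zero polarized
  rw [discrim] at discriminant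
  obtain h0 | hpos := (nonneg (T x)).eq_or_lt
  · exact h0 ▸ mul_nonneg (sq_nonneg c) (nonneg x)
  · exact le_of_mul_le_mul_left (by linarith) hpos

theorem Expands.dot_walkOp_walkOp_le {ε : ℝ} (hs : Expands V s ε) (hε : 0 ≤ ε) {σ : X ≃ X}
    (hσ : ∀ x, s (σ x) = (s x)⁻¹) (f : V →₀ ℝ) :
    dot V (walkOp V s f) (walkOp V s f) ≤
      √((Fintype.card X : ℝ) ^ 2 - ε ^ 2) ^ 2 * dot V f f := by
  refine apply_apply_le_of_abs_apply_le dot_comm dot_self_nonneg (dot_walkOp_comm hσ)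
    (fun f => (Real.abs_le_sqrt (hs.sq_dot_walkOp_le hε f)).trans_eq ?_) f
  rw [Real.sqrt_mul' _ (sq_nonneg _), Real.sqrt_sq (dot_self_nonneg f)]

theorem Expands.dot_walkOp_pow_le {ε : ℝ} (hs : Expands V s ε) (hε : 0 ≤ ε) {σ : X ≃ X}
    (hσ : ∀ x, s (σ x) = (s x)⁻¹) (f : V →₀ ℝ) (n : ℕ) :
    dot V ((walkOp V s ^ n) f) ((walkOp V s ^ n) f) ≤
      (√((Fintype.card X : ℝ) ^ 2 - ε ^ 2) ^ n) ^ 2 * dot V f f := by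
  induction n with
  | zero => simp
  | succ n ih =>
    rw [pow_succ' (walkOp V s), Module.End.mul_apply, pow_succ' √_, mul_pow, mul_assoc]
    exact (hs.dot_walkOp_walkOp_le hε hσ _).trans (mul_le_mul_of_nonneg_left ih (sq_nonneg _))

end Walk

section ReturningWords

variable {G V A : Type*} [Group G] [MulAction G V] [Fintype A]

theorem walkOp_pow_single (π : A → G) (o : V) (n : ℕ) :
    (walkOp V (letterVal π) ^ n) (Finsupp.single o 1) =
      ∑ u : Fin n → A × Bool, Finsupp.single (wordVal π (List.ofFn u) • o) 1 := by
  induction n with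
  | zero => simp
  | succ n ih =>
    rw [pow_succ', Module.End.mul_apply, ih, map_sum,
      ← (Fin.consEquiv fun _ => A × Bool).sum_comp, Fintype.sum_prod_type_right]
    refine Finset.sum_congr rfl fun u _ => ?_
    rw [walkOp_single]
    refine Finset.sum_congr rfl fun x _ => ?_
    rw [← mul_smul, ← wordVal_cons]
    exact congrArg (fun w => Finsupp.single (wordVal π w • o) 1) (List.ofFn_cons x u).symm

theorem Expands.nonempty {X : Type*} [Fintype X] {s : X → G} {ε : ℝ} (hs : Expands V s ε)
    (hε : 0 < ε) (o : V) : Nonempty X := by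
  by_contra hX
  rw [not_nonempty_iff] at hX
  simpa [hε.not_ge] using hs {o}

theorem Expands.exists_ncard_stabilizing_words_le {π : A → G} {ε : ℝ}
    (hs : Expands V (letterVal π) ε) (hε : 0 < ε) (o : V) :
    ∃ c : ℝ≥0, c < Fintype.card (A × Bool) ∧ ∀ n,
      ({u : Fin n → A × Bool | wordVal π (List.ofFn u) ∈ MulAction.stabilizer G o}.ncard : ℝ≥0) ≤
        c ^ n := by
  classical
  have := hs.nonempty hε o
  set d := (Fintype.card (A × Bool) : ℝ)
  have sqrt_lt : √(d ^ 2 - ε ^ 2) < d :=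
    (Real.sqrt_lt' (Nat.cast_pos.2 Fintype.card_pos)).2 (sub_lt_self _ (pow_pos hε 2))
  refine ⟨(√(d ^ 2 - ε ^ 2)).toNNReal, ?_, fun n => ?_⟩
  · rwa [← NNReal.coe_lt_coe, Real.coe_toNNReal _ (Real.sqrt_nonneg _), NNReal.coe_natCast]
  set f := (walkOp V (letterVal π) ^ n) (Finsupp.single o 1) with hf
  have count_eq : ({u : Fin n → A × Bool |
      wordVal π (List.ofFn u) ∈ MulAction.stabilizer G o}.ncard : ℝ) = f o := by
    rw [hf, walkOp_pow_single, Set.ncard_eq_toFinset_card']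
    simp [Finsupp.single_apply, MulAction.mem_stabilizer_iff]
  have dot_self_le : dot V f f ≤ (√(d ^ 2 - ε ^ 2) ^ n) ^ 2 := by
    have dot_single : dot V (Finsupp.single o 1) (Finsupp.single o 1) = 1 := by simp [dot]
    simpa only [dot_single, mul_one] using hs.dot_walkOp_pow_le hε.le
      (σ := (Equiv.refl A).prodCongr Equiv.boolNot) (letterVal_not π) (Finsupp.single o 1) n
  rw [← NNReal.coe_le_coe]
  push_cast
  rw [count_eq, Real.coe_toNNReal _ (Real.sqrt_nonneg _)]
  exact le_of_sq_le_sq ((sq_apply_le_dot_self f o).trans dot_self_le) (by positivity)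

end ReturningWords

/-! ### Averages with respect to length-invariant measures -/

section Averages

variable {X : Type*} [Fintype X]

theorem tsum_list_eq (F : List X → ℝ≥0∞) :
    ∑' w, F w = ∑' n, ∑ u : Fin n → X, F (List.ofFn u) := by
  rw [← List.equivSigmaTuple.symm.tsum_eq, ENNReal.tsum_sigma']
  exact tsum_congr fun n => tsum_fintype _

theorem LengthInvariant.tsum_mul_le [Nonempty X] {μ : PMF (List X)} (hμ : LengthInvariant μ)
    {F : List X → ℝ≥0∞} {C : ℝ≥0∞}
    (hF : ∀ n, ∑ u : Fin n → X, F (List.ofFn u) ≤ C * (Fintype.card X : ℝ≥0∞) ^ n) :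
    ∑' w, F w * μ w ≤ C := by
  obtain ⟨x⟩ := ‹Nonempty X›
  have apply_ofFn (n) (u : Fin n → X) : μ (List.ofFn u) = μ (List.replicate n x) := hμ _ _ (by simp)
  have total : ∑' n, (Fintype.card X : ℝ≥0∞) ^ n * μ (List.replicate n x) = 1 := by
    rw [← μ.tsum_coe, tsum_list_eq]
    simp [apply_ofFn]
  calc ∑' w, F w * μ w = ∑' n, (∑ u : Fin n → X, F (List.ofFn u)) * μ (List.replicate n x) := by
        simp only [tsum_list_eq, apply_ofFn, Finset.sum_mul]
    _ ≤ ∑' n, C * ((Fintype.card X : ℝ≥0∞) ^ n * μ (List.replicate n x)) := by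
        refine ENNReal.tsum_le_tsum fun n => ?_
        rw [← mul_assoc]
        gcongr
        exact hF n
    _ = C := by rw [ENNReal.tsum_mul_left, total, mul_one]

theorem LengthInvariant.tsum_mul_le_of_rare [Nonempty X] {μ : PMF (List X)}
    (hμ : LengthInvariant μ) {E : Set (List X)} {B c R : ℝ≥0} {F : List X → ℝ≥0∞}
    (hE : ∀ n, ({u : Fin n → X | List.ofFn u ∈ E}.ncard : ℝ≥0) ≤ c ^ n)
    (hcR : c * R ≤ Fintype.card X)
    (hF : ∀ w, F w ≤ 1 + E.indicator (fun w => (B : ℝ≥0∞) * (R : ℝ≥0∞) ^ w.length) w) :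
    ∑' w, F w * μ w ≤ 1 + B := by
  classical
  refine hμ.tsum_mul_le fun n => ?_
  have rare : ({u : Fin n → X | List.ofFn u ∈ E}.ncard : ℝ≥0∞) * (R : ℝ≥0∞) ^ n ≤
      (Fintype.card X : ℝ≥0∞) ^ n := by
    have := (mul_le_mul_left (hE n) (R ^ n)).trans
      ((mul_pow c R n).symm.trans_le (pow_le_pow_left₀ (by positivity) hcR n))
    exact_mod_cast this
  calc ∑ u : Fin n → X, F (List.ofFn u)
      ≤ ∑ u : Fin n → X, (1 + if List.ofFn u ∈ E then (B : ℝ≥0∞) * (R : ℝ≥0∞) ^ n else 0) :=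
        Finset.sum_le_sum fun u _ => by simpa [Set.indicator_apply] using hF (List.ofFn u)
    _ = (Fintype.card X : ℝ≥0∞) ^ n +
          B * ({u : Fin n → X | List.ofFn u ∈ E}.ncard * (R : ℝ≥0∞) ^ n) := by
        rw [Finset.sum_add_distrib, ← Finset.sum_filter, Set.ncard_eq_toFinset_card']
        simp [mul_left_comm]
    _ ≤ (1 + B) * (Fintype.card X : ℝ≥0∞) ^ n := by
        rw [add_mul, one_mul]
        gcongr

end Averages

theorem IsSubexponential.exists_le {g : ℕ → ℝ} (hg : IsSubexponential g) {R : ℝ} (hR : 1 < R) :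
    ∃ B : ℝ, ∀ m, g m ≤ B * R ^ m := by
  obtain ⟨B, hB⟩ := (hg R hR).bddAbove_range
  exact ⟨B, fun m => (div_le_iff₀ (by positivity)).1 (hB ⟨m, rfl⟩)⟩

theorem IsSubexponential.exists_partialSups_le {g : ℕ → ℕ}
    (hg : IsSubexponential fun n => (g n : ℝ)) {R : ℝ≥0} (hR : 1 < R) (k : ℕ) :
    ∃ B : ℝ≥0, ∀ n, (partialSups g (k * n) : ℝ≥0) ≤ B * R ^ n := by
  obtain ⟨Q, hQ, hQk⟩ : ∃ Q : ℝ≥0, 1 < Q ∧ Q ^ (k + 1) = R :=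
    ⟨R ^ ((k + 1 : ℕ) : ℝ)⁻¹, NNReal.one_lt_rpow hR (by positivity),
      NNReal.rpow_inv_natCast_pow _ k.succ_ne_zero⟩
  obtain ⟨B, hB⟩ := hg.exists_le (R := Q) hQ
  refine ⟨B.toNNReal, fun n => ?_⟩
  obtain ⟨m, hm, sup_eq⟩ := exists_partialSups_eq g (k * n)
  have pow_le : Q ^ m ≤ R ^ n := by
    rw [← hQk, ← pow_mul]
    exact pow_le_pow_right₀ hQ.le (hm.trans (by gcongr; omega))
  rw [sup_eq]
  refine le_trans ?_ (mul_le_mul_right pow_le _)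
  rw [← NNReal.coe_le_coe]
  push_cast
  exact (hB m).trans (by gcongr; exact Real.le_coe_toNNReal B)

theorem TimeClass.exists_linear_add_comp_le (𝓒 : TimeClass) {f : ℕ → ℕ} (hf : f ∈ 𝓒.bounds)
    (k : ℕ) :
    ∃ F ∈ 𝓒.bounds, (∀ n, 0 < F n) ∧ ∀ n, k * (n + 1) + f (k * n) ≤ F n := by
  refine ⟨_, 𝓒.closed f hf (k + 2) (by omega), fun n => by positivity, fun n => ?_⟩
  have le_f := 𝓒.le_apply f hf ((k + 2) * n + (k + 2))
  have f_le := 𝓒.monotone f hf (show k * n ≤ (k + 2) * n + (k + 2) by nlinarith)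
  nlinarith

theorem DecidableInTime.mono {α : Type*} {L : Language α} {f g : ℕ → ℕ} (hfg : f ≤ g)
    (h : DecidableInTime L f) : DecidableInTime L g :=
  let ⟨M, hM, htime⟩ := h
  ⟨M, hM, fun w => (htime w).trans (mod_cast hfg _)⟩

theorem TimeClass.containsOnAverage_of_rare (𝓒 : TimeClass) {X : Type*} [Fintype X]
    {L : Language X} {E : Set (List X)} {c : ℝ≥0} (hc : c < Fintype.card X)
    (hE : ∀ n, ({u : Fin n → X | List.ofFn u ∈ E}.ncard : ℝ≥0) ≤ c ^ n)
    {f g : ℕ → ℕ} (hf : f ∈ 𝓒.bounds) (hg : IsSubexponential fun n => (g n : ℝ))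
    {N : MultiTapeTM X} (hN : N.Decides L) {k : ℕ}
    (htime : ∀ w, N.time w ≤
      ((k * (w.length + 1) + f (k * w.length) + partialSups g (k * w.length) : ℕ) : ℕ∞) ∧
      (w ∉ E → N.time w ≤ ((k * (w.length + 1) + f (k * w.length) : ℕ) : ℕ∞))) :
    𝓒.ContainsOnAverage L {μ | LengthInvariant μ} := by
  have d_pos : (0 : ℝ≥0) < Fintype.card X := (zero_le).trans_lt hc
  have : Nonempty X := Fintype.card_pos_iff.1 (mod_cast d_pos)
  obtain ⟨R, hR, hcR⟩ : ∃ R : ℝ≥0, 1 < R ∧ c * R ≤ Fintype.card X := by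
    refine ⟨2 * Fintype.card X / (c + Fintype.card X), ?_, ?_⟩
    · rw [one_lt_div (by positivity), two_mul]
      gcongr
    · rw [mul_div_assoc', div_le_iff₀ (by positivity), mul_left_comm, two_mul, mul_comm c,
        ← mul_add]
      gcongr
  obtain ⟨F, hF, F_pos, le_F⟩ := 𝓒.exists_linear_add_comp_le hf k
  obtain ⟨B, hB⟩ := hg.exists_partialSups_le hR k
  refine ⟨N, F, hF, hN, 𝓒.monotone F hF, F_pos, 1 + B, by positivity, fun μ hμ => ?_⟩
  push_cast
  refine LengthInvariant.tsum_mul_le_of_rare hμ hE hcR fun w => ENNReal.div_le_of_le_mul ?_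
  by_cases hw : w ∈ E
  · have one_le_F : (1 : ℝ≥0∞) ≤ F w.length := mod_cast F_pos w.length
    have slow_le : (partialSups g (k * w.length) : ℝ≥0∞) ≤ B * (R : ℝ≥0∞) ^ w.length :=
      mod_cast hB w.length
    calc (N.time w : ℝ≥0∞)
        ≤ ((F w.length + partialSups g (k * w.length) : ℕ) : ℕ∞) :=
          ENat.toENNReal_le.2 ((htime w).1.trans (mod_cast Nat.add_le_add_right (le_F _) _))
      _ ≤ F w.length + B * (R : ℝ≥0∞) ^ w.length * F w.length := by
          push_cast
          exact add_le_add le_rfl (slow_le.trans (le_mul_of_one_le_right' one_le_F))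
      _ = _ := by rw [Set.indicator_of_mem hw, add_mul, one_mul]
  · rw [Set.indicator_of_notMem hw, add_zero, one_mul]
    exact ENat.toENNReal_le.2 (((htime w).2 hw).trans (Nat.cast_le.2 (le_F w.length)))

/-! ### The skew product along the rewriting cocycle -/

open ActionCocycle in
theorem HasNonamenableSchreierGraph.exists_expands_schreier {G Γ A : Type*} [Group G] [Group Γ]
    [Fintype A] {K : Subgroup Γ} (hK : HasNonamenableSchreierGraph K) {G₁ : Subgroup G}
    [G₁.FiniteIndex] {φ : G₁ →* Γ} (hφ : Function.Surjective φ) {π : A → G} (hπ : Generates π) :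
    ∃ ε : ℝ, 0 < ε ∧
      Expands (((schreier G₁).map φ).SkewProduct (Γ ⧸ K)) (letterVal π) ε := by
  have := Fintype.ofFinite (G ⧸ G₁)
  obtain ⟨n, ρ, -, hρ⟩ := hK
  obtain ⟨ε, hε, hexp⟩ := hρ.exists_expands
  have surjective (c : G ⧸ G₁) (γ : Γ) : ∃ g : G, g • c = c ∧ (schreier G₁).map φ g c = γ := by
    obtain ⟨h, rfl⟩ := hφ γ
    obtain ⟨g, hg, rfl⟩ := exists_schreier_eq c h
    exact ⟨g, hg, rfl⟩
  obtain ⟨s, hs⟩ := hexp.skewProduct ((schreier G₁).map φ) surjective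
  exact hs.of_generates hε hπ

theorem ActionCocycle.mem_stabilizer_schreier_point {G Γ : Type*} [Group G] [Group Γ]
    {G₁ : Subgroup G} {φ : G₁ →* Γ} {K : Subgroup Γ} (g : G₁) :
    (g : G) ∈ MulAction.stabilizer G
      (((schreier G₁).map φ).point ((1 : G) : G ⧸ G₁) ((1 : Γ) : Γ ⧸ K)) ↔ φ g ∈ K := by
  rw [mem_stabilizer_point, smul_coset_one_eq_iff, map_apply, schreier_coset_one]
  exact and_iff_right g.2

theorem theoremC_general {G Gbar : Type*} [Group G] [Group Gbar]
    (𝓒 : TimeClass) (H G₁ : Subgroup G) (hH : MembershipInSubExp H)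
    (hG₁ : G₁.FiniteIndex) (hHG₁ : H ≤ G₁)
    (φ : G₁ →* Gbar) (hφ : Function.Surjective φ)
    (K : Subgroup Gbar) (hHK : (H.subgroupOf G₁).map φ ≤ K)
    (hKna : HasNonamenableSchreierGraph K) (hK : MembershipIn 𝓒 K)
    {A : Type*} [Finite A] (π : A → G) (hπ : Generates π) :
    𝓒.ContainsOnAverage (membershipProblem π H)
      {μ : PMF (List (A × Bool)) | LengthInvariant μ} := by
  have := Fintype.ofFinite A
  set r := (ActionCocycle.schreier G₁).map φ
  set o := r.point ((1 : G) : G ⧸ G₁) ((1 : Gbar) : Gbar ⧸ K)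
  have H_le_stabilizer : H ≤ MulAction.stabilizer G o := fun h hh =>
    (ActionCocycle.mem_stabilizer_schreier_point ⟨h, hHG₁ hh⟩).2 (hHK ⟨⟨h, hHG₁ hh⟩, hh, rfl⟩)
  obtain ⟨ε, hε, expands⟩ := hKna.exists_expands_schreier hφ hπ
  obtain ⟨c, hc, rare⟩ := expands.exists_ncard_stabilizing_words_le hε o
  obtain ⟨_, ρ₁, hρ₁, f, hf, decidable_K⟩ := hK
  obtain ⟨_, ρ₂, hρ₂, g, hg, decidable_H⟩ := hH
  obtain ⟨N, decides, k, time_le⟩ := exists_machine_membershipProblem r _ (π := π) hρ₁ hρ₂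
    H_le_stabilizer (𝓒.monotone f hf) (partialSups g).monotone decidable_K
    (decidable_H.mono (le_partialSups g))
  exact 𝓒.containsOnAverage_of_rare (E := {w | wordVal π w ∈ MulAction.stabilizer G o})
    hc rare hf hg decides time_le

theorem theoremC {G Gbar : Type*} [Group G] [Group.IsFinitelyPresented G] [Group Gbar]
    (𝓒 : TimeClass) (h𝓒 : 𝓒.SubsetSubExp)
    (H G₁ : Subgroup G) (hH : MembershipInSubExp H)
    (hG₁ : G₁.FiniteIndex) (hHG₁ : H ≤ G₁)
    (φ : G₁ →* Gbar) (hφ : Function.Surjective φ)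
    (K : Subgroup Gbar) (hHK : (H.subgroupOf G₁).map φ ≤ K)
    (hKna : HasNonamenableSchreierGraph K) (hK : MembershipIn 𝓒 K)
    {A : Type*} [Finite A] (π : A → G) (hπ : Generates π) :
    𝓒.ContainsOnAverage (membershipProblem π H)
      {μ : PMF (List (A × Bool)) | LengthInvariant μ} :=
  theoremC_general 𝓒 H G₁ hH hG₁ hHG₁ φ hφ K hHK hKna hK π hπ
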